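/- **Differential privacy of DP-Fed and DP-Fed-LS with uniform client subsampling.** *Algorithm.* There are $N\ge 1$ clients. Client $j$ has a loss function $f_j(w,z)$ on $\mathbb{R}^d$, a finite local dataset, and an arbitrary rule for drawing its $K$ random mini-batches in each communication round. Let $\tau\in(0,1]$ with $S=\tau N$ an integer, $T$ the number of rounds, $\mathcal{L}>0$ the clipping parameter, $\eta_l,\eta_g$ the local and global learning rates, $\nu$ the noise level, $\sigma\ge 0$ the smoothing factor, $w^0\in\mathbb{R}^d$ the initial model and $a_0,\dots,a_T\in[0,1]$ weights with $\sum_t a_t=1$. Put $\mathrm{clip}(v,\mathcal{L})=v/\max(1,\|v\|_2/\mathcal{L})$ and $A_\sigma=I+\sigma L$, where $L$ is the $d\times d$ Laplacian matrix of the cycle graph (circulant with first row $(2,-1,0,\dots,0,-1)$; for every $d$, $L=2I-P-P^{\top}$ with $P$ the cyclic shift). For $t=0,\dots,T-1$: * a set $\mathcal{S}_t$ of $S$ clients is drawn uniformly among all $S$-element sets of clients; * each $j\in\mathcal{S}_t$ starts from $w_j^{t,0}=w^t$, computes, for $i=0,\dots,K-1$, $$w_j^{t,i+1}=w^t+\mathrm{clip}\big(w_j^{t,i}-\eta_l\,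 g_j(w_j^{t,i})-w^t,\ \mathcal{L}\big),$$ where $g_j$ is the gradient of $f_j$ averaged over the $i$-th mini-batch, and returns $\Delta_j^t=w_j^{t,K}-w^t$; * the server sets $$w^{t+1}=w^t+\frac{\eta_g}{S}A_\sigma^{-1}\Big(\sum_{j\in\mathcal{S}_t}\Delta_j^t+\mathbf{n}_t\Big),\qquad \mathbf{n}_t\sim\mathcal{N}(0,\nu^2I).$$ The active sets, the mini-batches of the different clients and the noise vectors are independent of each other and across rounds. The output is $\bar w^T=\sum_{t=0}^T a_t w^t$. This algorithm is DP-Fed-LS; the case $\sigma=0$ (that is, $A_\sigma=I$) is DP-Fed. *Privacy notion.* A dataset is a sequence $D$ of $N$ clients; $D$ and $D'$ are adjacent if $D'$ arises from $D$ by replacing one client by another. A randomized mechanism $\mathcal{M}$ with values in $\mathbb{R}^d$ is $(\varepsilon,\delta)$-DP if $\mathbb{P}[\mathcal{M}(D)\in O]\le e^{\varepsilon}\,\mathbb{P}[\mathcal{M}(D')\in O]+\delta$ for all adjacent $D,D'$ and all Borel sets $O\subseteq\mathbb{R}^d$. *Theorem.* Let $\varepsilon>0$ and $\delta\in(0,1)$.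 Suppose that there is $\lambda\in(0,1)$ such that, with $\alpha=\dfrac{\log(1/\delta)}{(1-\lambda)\varepsilon}+1$, $$\nu\ \ge\ \frac{\tau\mathcal{L}}{\varepsilon}\sqrt{\frac{14T}{\lambda}\Big(\frac{\log(1/\delta)}{1-\lambda}+\varepsilon\Big)},\qquad \frac{\nu^2}{4\mathcal{L}^2}\ \ge\ \frac23,\qquad \alpha-1\ \le\ \frac{\nu^2}{6\mathcal{L}^2}\,\log\frac{1}{\tau\alpha\big(1+\nu^2/(4\mathcal{L}^2)\big)}.$$ Then DP-Fed-LS and DP-Fed with uniform subsampling, viewed as mechanisms mapping a sequence of $N$ clients to the output $\bar w^T$, are $(\varepsilon,\delta)$-DP. -/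

import Mathlib

open MeasureTheory ProbabilityTheory
open scoped Matrix

noncomputable section

namespace DPFed

/-! ### Differential privacy -/

/-- `(ε, δ)`-differential privacy of a randomized mechanism `M`, given by the law `M D` of its
output on the dataset `D`, with respect to an adjacency relation `adj` on datasets. -/
def IsDP {X Y : Type*} [MeasurableSpace Y] (adj : X → X → Prop) (M : X → Measure Y)
    (ε δ : ℝ) : Prop :=
  ∀ D D' : X, adj D D' → ∀ O : Set Y, MeasurableSet O →
    (M D).real O ≤ Real.exp ε * (M D').real O + δ

/-- Replace-one adjacency: one entry of `D` is replaced by another one. -/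
def ReplaceOne {N : ℕ} {C : Type*} (D D' : Fin N → C) : Prop :=
  ∃ j : Fin N, ∀ i : Fin N, i ≠ j → D i = D' i

/-! ### Laplacian smoothing -/

/-- The `d × d` matrix of the cyclic shift `i ↦ i + 1`. -/
def cyclicShift (d : ℕ) : Matrix (Fin d) (Fin d) ℝ := (finRotate d).permMatrix ℝ

/-- The Laplacian matrix of the cycle graph on `d` vertices: the circulant matrix with first row
`(2, -1, 0, …, 0, -1)`. -/
def cycleLaplacian (d : ℕ) : Matrix (Fin d) (Fin d) ℝ :=
  (2 : ℝ) • (1 : Matrix (Fin d) (Fin d) ℝ) - cyclicShift d - (cyclicShift d)ᵀ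

/-- The smoothing matrix `A_σ = I + σ L`. -/
def smoothingMatrix (d : ℕ) (σ : ℝ) : Matrix (Fin d) (Fin d) ℝ := 1 + σ • cycleLaplacian d

lemma smoothingMatrix_zero (d : ℕ) : smoothingMatrix d 0 = 1 := by
  simp [smoothingMatrix]

lemma cycleLaplacian_eq (d : ℕ) :
    cycleLaplacian d = (cyclicShift d - 1)ᴴ * (cyclicShift d - 1) := by
  have h : (cyclicShift d)ᵀ * cyclicShift d = 1 := by
    rw [cyclicShift, Matrix.transpose_permMatrix, ← Matrix.permMatrix_mul]
    simp
  rw [Matrix.conjTranspose_eq_transpose_of_trivial, Matrix.transpose_sub, Matrix.transpose_one,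
    Matrix.sub_mul, Matrix.mul_sub, h, cycleLaplacian, two_smul]
  simp only [Matrix.mul_one, Matrix.one_mul]
  abel

/-- `A_σ` is positive definite, so that `A_σ⁻¹` is a genuine inverse. -/
lemma smoothingMatrix_posDef (d : ℕ) {σ : ℝ} (hσ : 0 ≤ σ) : (smoothingMatrix d σ).PosDef := by
  rw [smoothingMatrix, cycleLaplacian_eq]
  exact Matrix.PosDef.one.add_posSemidef
    ((Matrix.posSemidef_conjTranspose_mul_self _).smul hσ)

/-! ### Clients and local updates -/

/-- Mini-batches of a local dataset of size `n`: finite multisets of sample indices. -/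
instance instMeasurableSpaceBatch (n : ℕ) : MeasurableSpace (Multiset (Fin n)) := ⊤

/-- A client: a loss function `f_j(w, z)`, a local dataset `z_1, …, z_n`, and the joint law of the
`K` random mini-batches used by the client in one communication round.  This law is arbitrary, so
that batches of fixed or varying size, with or without replacement, drawn independently in each
local step or running through the local dataset in epochs, are all covered. -/
structure Client (d : ℕ) (Z : Type*) (K : ℕ) where
  loss : EuclideanSpace ℝ (Fin d) → Z → ℝ
  size : ℕ
  data : Fin size → Z
  batchLaw : PMF (Fin K → Multiset (Fin size))

variable {d K N : ℕ} {Z : Type*}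

/-- The mini-batch gradient `|B|⁻¹ ∑_{k ∈ B} ∇_w f_j(w, z_k)`. -/
def Client.batchGradient (c : Client d Z K) (B : Multiset (Fin c.size))
    (w : EuclideanSpace ℝ (Fin d)) : EuclideanSpace ℝ (Fin d) :=
  (B.card : ℝ)⁻¹ • (B.map fun k => gradient (fun u => c.loss u (c.data k)) w).sum

/-- `clip(v, L) = v / max(1, ‖v‖₂ / L)`. -/
def clip (L : ℝ) (v : EuclideanSpace ℝ (Fin d)) : EuclideanSpace ℝ (Fin d) :=
  (max 1 (‖v‖ / L))⁻¹ • v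

/-- The local models `w_j^{t,0}, …, w_j^{t,K}` of a client, started at the global model `w = w^t`
and computed with the mini-batches `B`. -/
def Client.localModel (c : Client d Z K) (η L : ℝ) (B : Fin K → Multiset (Fin c.size))
    (w : EuclideanSpace ℝ (Fin d)) : Fin (K + 1) → EuclideanSpace ℝ (Fin d) :=
  Fin.induction w fun i u => w + clip L (u - η • c.batchGradient (B i) u - w)

/-- The model update `Δ_j^t = w_j^{t,K} - w^t` returned by a client. -/
def Client.update (c : Client d Z K) (η L : ℝ) (B : Fin K → Multiset (Fin c.size))
    (w : EuclideanSpace ℝ (Fin d)) : EuclideanSpace ℝ (Fin d) :=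
  c.localModel η L B w (Fin.last K) - w

/-! ### The server -/

/-- The parameters of the algorithm. -/
structure Params (d : ℕ) where
  /-- number `S` of active clients per round -/
  active : ℕ
  /-- number `T` of communication rounds -/
  rounds : ℕ
  /-- clipping parameter -/
  clipping : ℝ
  /-- local learning rate -/
  localRate : ℝ
  /-- global learning rate -/
  globalRate : ℝ
  /-- noise level: standard deviation of each coordinate of the injected noise -/
  noise : ℝ
  /-- smoothing factor -/
  smoothing : ℝ
  /-- initial model `w^0` -/
  init : EuclideanSpace ℝ (Fin d)
  /-- output weights `a_0, …, a_T` -/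
  weight : Fin (rounds + 1) → ℝ

/-- The Gaussian law `N(0, ν² I)` on `ℝ^d`. -/
def gaussianNoise (d : ℕ) (ν : ℝ) : Measure (EuclideanSpace ℝ (Fin d)) :=
  (Measure.pi fun _ : Fin d => gaussianReal 0 (ν ^ 2).toNNReal).map (WithLp.toLp 2)

/-- The randomness of one round: the set of active clients, the mini-batches of every client
(those of inactive clients are not used) and the noise vector. -/
abbrev RoundSpace (D : Fin N → Client d Z K) : Type :=
  Finset (Fin N) × ((j : Fin N) → Fin K → Multiset (Fin (D j).size)) × EuclideanSpace ℝ (Fin d)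

/-- The law of the randomness of one round with uniform subsampling: the active set is uniform
among all sets of `S` clients, the clients' mini-batches and the noise are drawn from their laws,
and all of these are independent. -/
def roundLaw (p : Params d) (D : Fin N → Client d Z K) : Measure (RoundSpace D) :=
  (uniformOn {A : Finset (Fin N) | A.card = p.active}).prod
    ((Measure.pi fun j => (D j).batchLaw.toMeasure).prod (gaussianNoise d p.noise))

/-- One round: `w^{t+1} = w^t + (η_g / S) A_σ⁻¹ (∑_{j active} Δ_j^t + n)`. -/
def serverStep (p : Params d) (D : Fin N → Client d Z K) (w : EuclideanSpace ℝ (Fin d))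
    (r : RoundSpace D) : EuclideanSpace ℝ (Fin d) :=
  w + (p.globalRate / p.active) •
    Matrix.toEuclideanCLM (𝕜 := ℝ) (smoothingMatrix d p.smoothing)⁻¹
      (∑ j ∈ r.1, (D j).update p.localRate p.clipping (r.2.1 j) w + r.2.2)

/-- The global models `w^0, …, w^T` produced with the randomness `ω` of the `T` rounds. -/
def globalModel (p : Params d) (D : Fin N → Client d Z K) (ω : Fin p.rounds → RoundSpace D) :
    Fin (p.rounds + 1) → EuclideanSpace ℝ (Fin d) :=
  Fin.induction p.init fun t w => serverStep p D w (ω t)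

/-- The output `∑_{t=0}^T a_t w^t`. -/
def output (p : Params d) (D : Fin N → Client d Z K) (ω : Fin p.rounds → RoundSpace D) :
    EuclideanSpace ℝ (Fin d) :=
  ∑ t, p.weight t • globalModel p D ω t

/-- DP-Fed-LS with uniform subsampling, as a randomized mechanism on sequences of `N` clients: the
law of the output when the randomness of the `T` rounds is independent. -/
def dpFedLS (p : Params d) (D : Fin N → Client d Z K) : Measure (EuclideanSpace ℝ (Fin d)) :=
  (Measure.pi fun _ : Fin p.rounds => roundLaw p D).map (output p D)

/-- DP-Fed with uniform subsampling: the algorithm without smoothing, `A_σ = I`. -/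
def dpFed (p : Params d) (D : Fin N → Client d Z K) : Measure (EuclideanSpace ℝ (Fin d)) :=
  dpFedLS { p with smoothing := 0 } D

/-! ### The output is a random variable and its law a probability measure -/

instance instDiscreteMeasurableSpaceBatch (n : ℕ) : DiscreteMeasurableSpace (Multiset (Fin n)) := ⟨fun _ => trivial⟩

instance isProbabilityMeasure_gaussianNoise (d : ℕ) (ν : ℝ) : IsProbabilityMeasure (gaussianNoise d ν) :=
  Measure.isProbabilityMeasure_map (by fun_prop)

lemma isProbabilityMeasure_roundLaw (p : Params d) (D : Fin N → Client d Z K)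
    (h : p.active ≤ N) : IsProbabilityMeasure (roundLaw p D) := by
  have : IsProbabilityMeasure (uniformOn {A : Finset (Fin N) | A.card = p.active}) := by
    apply isProbabilityMeasure_uniformOn (Set.toFinite _)
    obtain ⟨A, -, hA⟩ := Finset.exists_subset_card_eq (s := (Finset.univ : Finset (Fin N)))
      (n := p.active) (by simpa using h)
    exact ⟨A, hA⟩
  unfold roundLaw
  infer_instance

lemma Client.measurable_batchGradient (c : Client d Z K) (B : Multiset (Fin c.size)) :
    Measurable (c.batchGradient B) := by
  have h : ∀ k, Measurable (gradient fun u => c.loss u (c.data k)) := fun k =>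
    (InnerProductSpace.toDual ℝ _).symm.continuous.measurable.comp (measurable_fderiv ℝ _)
  unfold Client.batchGradient
  refine (measurable_const_smul ((B.card : ℝ)⁻¹)).comp ?_
  induction B using Multiset.induction_on with
  | empty => simp
  | cons k B ih =>
    simp only [Multiset.map_cons, Multiset.sum_cons]
    exact (h k).add ih

lemma measurable_clip (L : ℝ) :
    Measurable (clip L : EuclideanSpace ℝ (Fin d) → EuclideanSpace ℝ (Fin d)) := by
  unfold clip
  fun_prop

lemma Client.measurable_update (c : Client d Z K) (η L : ℝ)
    (B : Fin K → Multiset (Fin c.size)) : Measurable (c.update η L B) := by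
  have h : ∀ i, Measurable fun w => c.localModel η L B w i := by
    intro i
    induction i using Fin.induction with
    | zero => exact measurable_id
    | succ i ih =>
      simp only [Client.localModel, Fin.induction_succ] at ih ⊢
      exact measurable_id.add ((measurable_clip L).comp
        ((ih.sub (((c.measurable_batchGradient (B i)).comp ih).const_smul η)).sub measurable_id))
  exact (h _).sub measurable_id

lemma measurable_serverStep (p : Params d) (D : Fin N → Client d Z K) :
    Measurable fun x : EuclideanSpace ℝ (Fin d) × RoundSpace D => serverStep p D x.1 x.2 := by
  classical
  have hu : ∀ j, Measurable fun x : EuclideanSpace ℝ (Fin d) × RoundSpace D =>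
      (D j).update p.localRate p.clipping (x.2.2.1 j) x.1 := by
    intro j
    have h : Measurable fun y : (Fin K → Multiset (Fin (D j).size)) × EuclideanSpace ℝ (Fin d) =>
        (D j).update p.localRate p.clipping y.1 y.2 :=
      measurable_from_prod_countable_right fun B => (D j).measurable_update _ _ B
    exact h.comp (by fun_prop : Measurable fun x : EuclideanSpace ℝ (Fin d) × RoundSpace D =>
      (x.2.2.1 j, x.1))
  have hs : Measurable fun x : EuclideanSpace ℝ (Fin d) × RoundSpace D =>
      ∑ j ∈ x.2.1, (D j).update p.localRate p.clipping (x.2.2.1 j) x.1 := by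
    have : (fun x : EuclideanSpace ℝ (Fin d) × RoundSpace D =>
        ∑ j ∈ x.2.1, (D j).update p.localRate p.clipping (x.2.2.1 j) x.1) =
        fun x => ∑ j, if j ∈ x.2.1 then
          (D j).update p.localRate p.clipping (x.2.2.1 j) x.1 else 0 := by
      ext1 x
      simp
    rw [this]
    refine Finset.measurable_sum _ fun j _ => Measurable.ite ?_ (hu j) measurable_const
    exact (by fun_prop : Measurable fun x : EuclideanSpace ℝ (Fin d) × RoundSpace D => x.2.1)
      (MeasurableSet.of_discrete (s := {A : Finset (Fin N) | j ∈ A}))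
  unfold serverStep
  refine measurable_fst.add ((measurable_const_smul (p.globalRate / p.active)).comp ?_)
  exact (Matrix.toEuclideanCLM (𝕜 := ℝ) _).continuous.measurable.comp (hs.add (by fun_prop))

lemma measurable_output (p : Params d) (D : Fin N → Client d Z K) : Measurable (output p D) := by
  have h : ∀ t, Measurable fun ω => globalModel p D ω t := by
    intro t
    induction t using Fin.induction with
    | zero => exact measurable_const
    | succ t ih =>
      simp only [globalModel, Fin.induction_succ] at ih ⊢
      exact (measurable_serverStep p D).comp (ih.prodMk (measurable_pi_apply t))
  exact Finset.measurable_sum _ fun t _ => (measurable_const_smul (p.weight t)).comp (h t)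

lemma isProbabilityMeasure_dpFedLS (p : Params d) (D : Fin N → Client d Z K)
    (h : p.active ≤ N) : IsProbabilityMeasure (dpFedLS p D) := by
  have := isProbabilityMeasure_roundLaw p D h
  exact Measure.isProbabilityMeasure_map (measurable_output p D).aemeasurable

end DPFed

end

/-! Both algorithms are instances of adaptive composition followed by post-processing: the output is
a function of the noisy sums of client updates that the server receives in the `T` rounds;
smoothing and averaging belong to the post-processing.

Privacy is measured by the Rényi divergence of order `α`, in the dual form `HolderDominated`:
by Hölder duality, `E_Q[(dP/dQ) ^ α] ≤ C ^ α` holds exactly if `∫ f dP ≤ C (∫ f ^ β dQ) ^ (1 / β)`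
for all `f ≥ 0`, where `β = α / (α - 1)`.  In this form stability under post-processing
(`HolderDominated.map`), under mixtures (Jensen's inequality, `lintegral_rpow_one_div_le`) and under
adaptive composition (`HolderDominated.trajectory`) is immediate, without densities of laws of
trajectories, and applying it to indicators gives `(ε, δ)`-privacy
(`HolderDominated.measureReal_le`).

The remaining point is that one round costs at most `ρ = 7 / 2 * τ ^ 2 * α * s`, where
`s = (2 L / ν) ^ 2` is the squared ratio of sensitivity and noise (`holderDominated_noisySum`); the
hypothesis on `ν` says `T ρ ≤ λ ε`, and converting to `(ε, δ)`-privacy costs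
`log (1 / δ) / (α - 1) = (1 - λ) ε`.  Let `j` be the client that is replaced.  A uniform active set
can be drawn by choosing a set `A ∋ j` and a client `k ∉ A` and then, with probability `1 - τ`,
exchanging `j` for `k` (`lintegral_uniformOn_card_eq`).  Given `A`, `k` and the mini-batches, the
noisy sums for the two datasets are Gaussian mixtures `(1 - τ) R + τ P` and `(1 - τ) R + τ Q` with a
common component `R`, and because of the clipping the centres of `R`, `P` and `Q` are pairwise
within distance `2 L`.

For such mixtures the moment of order `α` is estimated by expanding `(1 + x) ^ α` to second order
at the relative difference `x` of the densities (`PowerExpansion`, `mixture_rpow_mul_rpow_le`,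
`lintegral_mixture_rpow_le`); the first-order term integrates to `0`, and the second-order term
carries the factor `τ ^ 2` and the constant `2 (e ^ s - e ^ (s / 2)) ≤ 3.2 s`.  For `α ≤ 2` there
is no further term; otherwise there is one of order `n = 3` or `n = α`, and the upper bound on
`α - 1` makes the Gaussian moment `τ ^ n e ^ (n (n - 1) s / 2)` of order `τ ^ 2 s`
(`exists_powerExpansion`).  As `α` need not be an integer, the expansion is obtained from
Bernoulli's inequality for `α ≤ 3` and from Taylor's formula for `α ≥ 3`. -/

open scoped ENNReal

namespace DPFed

/-! ### A dual form of Rényi divergence bounds -/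

/-- The bound `∫ f dP ≤ C (∫ f ^ β dQ) ^ (1 / β)` for all measurable `f ≥ 0`.  If `α` and `β` are
conjugate exponents, this says that `dP/dQ` has norm at most `C` in `L^α(Q)`, that is, that the
Rényi divergence of order `α` of `P` from `Q` is at most `β log C`. -/
def HolderDominated {X : Type*} [MeasurableSpace X] (β : ℝ) (C : ℝ≥0∞) (P Q : Measure X) : Prop :=
  ∀ f : X → ℝ≥0∞, Measurable f → ∫⁻ x, f x ∂P ≤ C * (∫⁻ x, f x ^ β ∂Q) ^ (1 / β)

lemma HolderDominated.map {X Y : Type*} [MeasurableSpace X] [MeasurableSpace Y] {β : ℝ}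
    {C : ℝ≥0∞} {P Q : Measure X} (h : HolderDominated β C P Q) {g : X → Y} (hg : Measurable g) :
    HolderDominated β C (P.map g) (Q.map g) := by
  intro f hf
  rw [lintegral_map hf hg, lintegral_map (hf.pow_const β) hg]
  exact h _ (hf.comp hg)

/-- The privacy guarantee implied by a Rényi divergence bound: `P O ≤ (e ^ ρ Q O) ^ (1 / β)`, and
the right-hand side is a weighted geometric mean of `e ^ ε Q O` and `δ`. -/
lemma HolderDominated.measureReal_le {X : Type*} [MeasurableSpace X] {α ρ ε δ : ℝ}
    {P Q : Measure X} [IsFiniteMeasure P] [IsFiniteMeasure Q] (hα : 1 < α) (hδ : 0 < δ)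
    (hε : ρ + Real.log (1 / δ) / (α - 1) ≤ ε)
    (h : HolderDominated (α / (α - 1)) (ENNReal.ofReal (Real.exp (ρ * ((α - 1) / α)))) P Q)
    {O : Set X} (hO : MeasurableSet O) :
    P.real O ≤ Real.exp ε * Q.real O + δ := by
  have hα1 : 0 < α - 1 := by linarith
  have hα0 : 0 < α := by linarith
  have hβ : 0 < α / (α - 1) := by positivity
  have h1 := h (O.indicator 1) (measurable_one.indicator hO)
  have h2 : ∀ x, (O.indicator (1 : X → ℝ≥0∞) x) ^ (α / (α - 1)) = O.indicator 1 x := by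
    intro x
    by_cases hx : x ∈ O <;> simp [hx, hβ]
  simp only [h2, lintegral_indicator_one hO, one_div_div] at h1
  have h3 : P.real O ≤ Real.exp (ρ * ((α - 1) / α)) * Q.real O ^ ((α - 1) / α) := by
    rw [measureReal_def, measureReal_def, ENNReal.toReal_rpow,
      ← ENNReal.toReal_ofReal (Real.exp_pos (ρ * ((α - 1) / α))).le, ← ENNReal.toReal_mul]
    refine ENNReal.toReal_mono (ENNReal.mul_ne_top ENNReal.ofReal_ne_top ?_) h1
    exact ENNReal.rpow_ne_top_of_nonneg (by positivity) (measure_ne_top _ _)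
  have hy : 0 ≤ Q.real O := measureReal_nonneg
  have h4 : Real.exp (ρ * ((α - 1) / α)) ≤ Real.exp ε ^ ((α - 1) / α) * δ ^ (1 / α) := by
    rw [← Real.exp_mul, Real.rpow_def_of_pos hδ, ← Real.exp_add]
    refine Real.exp_le_exp.2 ?_
    have : ρ * ((α - 1) / α) + Real.log (1 / δ) / (α - 1) * ((α - 1) / α) ≤ ε * ((α - 1) / α) := by
      rw [← add_mul]
      gcongr
    have h5 : Real.log (1 / δ) / (α - 1) * ((α - 1) / α) = - (Real.log δ * (1 / α)) := by
      rw [one_div, Real.log_inv]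
      field_simp
    linarith
  have h6 : (α - 1) / α + 1 / α = 1 := by field_simp; ring
  have hw1 : (α - 1) / α ≤ 1 := by
    have : 0 < 1 / α := by positivity
    linarith
  have hw2 : 1 / α ≤ 1 := by
    have : 0 < (α - 1) / α := by positivity
    linarith
  calc P.real O ≤ Real.exp ε ^ ((α - 1) / α) * δ ^ (1 / α) * Q.real O ^ ((α - 1) / α) :=
        h3.trans (by gcongr)
    _ = (Real.exp ε * Q.real O) ^ ((α - 1) / α) * δ ^ (1 / α) := by
        rw [Real.mul_rpow (Real.exp_pos ε).le hy]; ring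
    _ ≤ (α - 1) / α * (Real.exp ε * Q.real O) + 1 / α * δ :=
        Real.geom_mean_le_arith_mean2_weighted (by positivity) (by positivity) (by positivity)
          hδ.le h6
    _ ≤ 1 * (Real.exp ε * Q.real O) + 1 * δ := by gcongr
    _ = _ := by ring

/-- Jensen's inequality for the concave function `x ↦ x ^ (1 / β)`. -/
lemma lintegral_rpow_one_div_le {X : Type*} [MeasurableSpace X] {μ : Measure X}
    [IsProbabilityMeasure μ] {β : ℝ} (hβ : 1 < β) {g : X → ℝ≥0∞} (hg : Measurable g) :
    ∫⁻ x, g x ^ (1 / β) ∂μ ≤ (∫⁻ x, g x ∂μ) ^ (1 / β) := by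
  have hβ0 : β ≠ 0 := by positivity
  have h := ENNReal.lintegral_mul_le_Lp_mul_Lq μ (Real.HolderConjugate.conjExponent hβ)
    (hg.pow_const (1 / β)).aemeasurable (measurable_const (a := (1 : ℝ≥0∞))).aemeasurable
  simpa [← ENNReal.rpow_mul, hβ0] using h

/-! ### Adaptive composition -/

/-- The trajectory of `n` steps `w ↦ s w r` driven by the noise sequence `ω`. -/
def trajectory {E Ω : Type*} (s : E → Ω → E) {n : ℕ} (w : E) (ω : Fin n → Ω) : Fin (n + 1) → E :=
  Fin.induction w fun t w => s w (ω t)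

lemma trajectory_succ {E Ω : Type*} (s : E → Ω → E) {n : ℕ} (w : E) (ω : Fin (n + 1) → Ω) :
    trajectory s w ω = Fin.cons w (trajectory s (s w (ω 0)) fun i => ω i.succ) := by
  funext i
  refine Fin.cases rfl (fun i => ?_) i
  rw [Fin.cons_succ]
  induction i using Fin.induction with
  | zero => rfl
  | succ i ih =>
    simp only [trajectory, Fin.induction_succ] at ih ⊢
    rw [← ih]
    rfl

lemma measurable_trajectory {E Ω : Type*} [MeasurableSpace E] [MeasurableSpace Ω]
    {s : E → Ω → E} (hs : Measurable fun x : E × Ω => s x.1 x.2) (n : ℕ) :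
    Measurable fun x : E × (Fin n → Ω) => trajectory s x.1 x.2 := by
  refine measurable_pi_lambda _ fun i => ?_
  induction i using Fin.induction with
  | zero => exact measurable_fst
  | succ i ih =>
    simp only [trajectory, Fin.induction_succ] at ih ⊢
    exact hs.comp (ih.prodMk ((measurable_pi_apply i).comp measurable_snd))

lemma lintegral_pi_fin_succ {Ω : Type*} [MeasurableSpace Ω] (μ : Measure Ω) [SigmaFinite μ]
    {n : ℕ} {f : (Fin (n + 1) → Ω) → ℝ≥0∞} (hf : Measurable f) :
    ∫⁻ ω, f ω ∂(Measure.pi fun _ => μ) =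
      ∫⁻ r, ∫⁻ ω, f (Fin.cons r ω) ∂(Measure.pi fun _ => μ) ∂μ := by
  have h := (measurePreserving_piFinSuccAbove (fun _ : Fin (n + 1) => μ) 0).symm
  rw [← h.lintegral_comp hf, lintegral_prod (fun x => f _) (hf.comp h.measurable).aemeasurable]
  simp [MeasurableEquiv.piFinSuccAbove_symm_apply, Fin.insertNthEquiv]

/-- Adaptive composition: if one step from any state is dominated with constant `C`, then the
whole trajectory of `n` steps is dominated with constant `C ^ n`. -/
lemma HolderDominated.trajectory {E Ω Ω' : Type*} [MeasurableSpace E] [MeasurableSpace Ω]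
    [MeasurableSpace Ω'] {μ : Measure Ω} [IsProbabilityMeasure μ] {μ' : Measure Ω'}
    [IsProbabilityMeasure μ'] {s : E → Ω → E} {s' : E → Ω' → E}
    (hs : Measurable fun x : E × Ω => s x.1 x.2) (hs' : Measurable fun x : E × Ω' => s' x.1 x.2)
    {β : ℝ} (hβ : 0 < β) {C : ℝ≥0∞}
    (h : ∀ w, HolderDominated β C (μ.map (s w)) (μ'.map (s' w))) (n : ℕ) (w : E) :
    HolderDominated β (C ^ n) ((Measure.pi fun _ : Fin n => μ).map (trajectory s w))
      ((Measure.pi fun _ : Fin n => μ').map (trajectory s' w)) := by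
  have hm : ∀ (n : ℕ) (w : E), Measurable (DPFed.trajectory s w (n := n)) := fun n w =>
    (measurable_trajectory hs n).comp measurable_prodMk_left
  have hm' : ∀ (n : ℕ) (w : E), Measurable (DPFed.trajectory s' w (n := n)) := fun n w =>
    (measurable_trajectory hs' n).comp measurable_prodMk_left
  have hs1 : ∀ w, Measurable (s w) := fun w => hs.comp measurable_prodMk_left
  have hs1' : ∀ w, Measurable (s' w) := fun w => hs'.comp measurable_prodMk_left
  induction n generalizing w with
  | zero =>
    intro f hf
    rw [lintegral_map hf (hm 0 w), lintegral_map (hf.pow_const β) (hm' 0 w)]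
    have e : ∀ ω ω', DPFed.trajectory s w (n := 0) ω = DPFed.trajectory s' w (n := 0) ω' := by
      intro ω ω'
      funext i
      rw [Fin.fin_one_eq_zero i]
      rfl
    have e' : ∀ ω, f (DPFed.trajectory s w (n := 0) ω) =
        f (DPFed.trajectory s' w (n := 0) finZeroElim) := fun ω => by rw [e ω]
    have e'' : ∀ ω, f (DPFed.trajectory s' w (n := 0) ω) ^ β =
        f (DPFed.trajectory s' w (n := 0) finZeroElim) ^ β :=
      fun ω => by rw [← e (fun i => i.elim0) ω, e _ finZeroElim]
    simp only [e', e'', lintegral_const, measure_univ, mul_one, pow_zero, one_mul]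
    rw [← ENNReal.rpow_mul, mul_one_div_cancel hβ.ne', ENNReal.rpow_one]
  | succ n ih =>
    intro f hf
    rw [lintegral_map hf (hm (n + 1) w), lintegral_map (hf.pow_const β) (hm' (n + 1) w),
      lintegral_pi_fin_succ _ (f := fun ω => f (DPFed.trajectory s w ω)) (hf.comp (hm (n + 1) w)),
      lintegral_pi_fin_succ _ (f := fun ω => f (DPFed.trajectory s' w ω) ^ β)
        ((hf.pow_const β).comp (hm' (n + 1) w))]
    simp only [trajectory_succ, Fin.cons_zero, Fin.cons_succ]
    have hcons : Measurable fun x : Fin (n + 1) → E => (Fin.cons w x : Fin (n + 2) → E) := by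
      refine measurable_pi_lambda _ fun i => ?_
      refine Fin.cases ?_ (fun i => ?_) i
      · exact measurable_const
      · exact measurable_pi_apply i
    set H : E → ℝ≥0∞ := fun u =>
      ∫⁻ ω, f (Fin.cons w (DPFed.trajectory s' u ω)) ^ β ∂(Measure.pi fun _ : Fin n => μ') with hH
    have hHm : Measurable H :=
      Measurable.lintegral_prod_right'
        (f := fun x : E × (Fin n → Ω') => f (Fin.cons w (DPFed.trajectory s' x.1 x.2)) ^ β)
        (((hf.comp hcons).comp (measurable_trajectory hs' n)).pow_const β)
    have h1 : ∀ r, ∫⁻ ω, f (Fin.cons w (DPFed.trajectory s (s w r) ω))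
        ∂(Measure.pi fun _ : Fin n => μ) ≤ C ^ n * H (s w r) ^ (1 / β) := by
      intro r
      have h2 := ih (s w r) _ (hf.comp hcons)
      rwa [lintegral_map (hf.comp hcons) (hm n _),
        lintegral_map ((hf.comp hcons).pow_const β) (hm' n _)] at h2
    have h3 := h w (fun u => H u ^ (1 / β)) (hHm.pow_const _)
    rw [lintegral_map (hHm.pow_const _) (hs1 w),
      lintegral_map ((hHm.pow_const _).pow_const _) (hs1' w)] at h3
    simp only [← ENNReal.rpow_mul, one_div_mul_cancel hβ.ne', ENNReal.rpow_one] at h3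
    calc _ ≤ ∫⁻ r, C ^ n * H (s w r) ^ (1 / β) ∂μ := lintegral_mono h1
      _ = C ^ n * ∫⁻ r, H (s w r) ^ (1 / β) ∂μ :=
        lintegral_const_mul _ ((hHm.pow_const _).comp (hs1 w))
      _ ≤ C ^ n * (C * (∫⁻ r, H (s' w r) ∂μ') ^ (1 / β)) := by gcongr
      _ = _ := by rw [← mul_assoc, ← pow_succ]

/-! ### Gaussian translations -/

/-- The density `exp ((⟪a, x⟫ - ‖a‖² / 2) / v)` of the Gaussian law `N(a, v I)` with respect to
`N(0, v I)`. -/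
noncomputable def gaussianTilt {d : ℕ} (v : ℝ) (a x : EuclideanSpace ℝ (Fin d)) : ℝ :=
  Real.exp ((inner ℝ a x - ‖a‖ ^ 2 / 2) / v)

lemma gaussianTilt_pos {d : ℕ} (v : ℝ) (a x : EuclideanSpace ℝ (Fin d)) :
    0 < gaussianTilt v a x := Real.exp_pos _

lemma measurable_gaussianTilt {d : ℕ} (v : ℝ) (a : EuclideanSpace ℝ (Fin d)) :
    Measurable (gaussianTilt v a) := by
  unfold gaussianTilt
  fun_prop

lemma gaussianReal_map_add_eq_withDensity {v : NNReal} (hv : v ≠ 0) (a : ℝ) :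
    (gaussianReal 0 v).map (a + ·) = (gaussianReal 0 v).withDensity
      fun x => ENNReal.ofReal (Real.exp ((a * x - a ^ 2 / 2) / v)) := by
  rw [gaussianReal_map_const_add, gaussianReal_of_var_ne_zero _ hv,
    gaussianReal_of_var_ne_zero _ hv, ← withDensity_mul _ (measurable_gaussianPDF 0 v) (by fun_prop)]
  congr 1
  funext x
  have hv' : (v : ℝ) ≠ 0 := by exact_mod_cast hv
  rw [Pi.mul_apply, gaussianPDF, gaussianPDF, ← ENNReal.ofReal_mul (gaussianPDFReal_nonneg _ _ _),
    gaussianPDFReal, gaussianPDFReal, mul_assoc _ (Real.exp _) (Real.exp _), ← Real.exp_add]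
  congr 3
  field_simp
  ring

lemma lintegral_prod_pi_eq_prod {ι : Type*} [Fintype ι] {X : ι → Type*}
    [∀ i, MeasurableSpace (X i)] (μ : ∀ i, Measure (X i)) [∀ i, IsProbabilityMeasure (μ i)]
    (f : ∀ i, X i → ℝ≥0∞) (hf : ∀ i, Measurable (f i)) :
    ∫⁻ x, ∏ i, f i (x i) ∂(Measure.pi μ) = ∏ i, ∫⁻ x, f i x ∂(μ i) := by
  rw [lintegral_prod_eq_prod_lintegral_of_indepFun Finset.univ
    (fun i (x : ∀ i, X i) => f i (x i)) (iIndepFun_pi fun i => (hf i).aemeasurable)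
    fun i => (hf i).comp (measurable_pi_apply i)]
  refine Finset.prod_congr rfl fun i _ => ?_
  exact (measurePreserving_eval μ i).lintegral_comp (hf i)

/-- The Cameron–Martin formula for the Gaussian law `N(0, ν² I)`. -/
lemma lintegral_add_gaussianNoise {d : ℕ} {ν : ℝ} (hν : ν ≠ 0) (a : EuclideanSpace ℝ (Fin d))
    {f : EuclideanSpace ℝ (Fin d) → ℝ≥0∞} (hf : Measurable f) :
    ∫⁻ x, f (a + x) ∂(gaussianNoise d ν) =
      ∫⁻ x, ENNReal.ofReal (gaussianTilt (ν ^ 2) a x) * f x ∂(gaussianNoise d ν) := by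
  set v : NNReal := (ν ^ 2).toNNReal with hv
  have hvν : (v : ℝ) = ν ^ 2 := Real.coe_toNNReal _ (sq_nonneg ν)
  have hv0 : v ≠ 0 := by
    intro h
    rw [h] at hvν
    exact hν (by simpa using hvν.symm)
  set t : Fin d → ℝ → ℝ≥0∞ :=
    fun i x => ENNReal.ofReal (Real.exp ((a i * x - a i ^ 2 / 2) / v)) with ht
  have htm : ∀ i, Measurable (t i) := fun i => by rw [ht]; fun_prop
  have hprod : ∀ x : Fin d → ℝ,
      ENNReal.ofReal (gaussianTilt (ν ^ 2) a (WithLp.toLp 2 x)) = ∏ i, t i (x i) := by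
    intro x
    rw [ht, ← ENNReal.ofReal_prod_of_nonneg fun i _ => (Real.exp_pos _).le, ← Real.exp_sum,
      gaussianTilt, EuclideanSpace.real_norm_sq_eq, hvν, ← Finset.sum_div]
    simp [PiLp.inner_apply, Finset.sum_sub_distrib, Finset.sum_div, mul_comm]
  have hpi : (Measure.pi fun _ : Fin d => gaussianReal 0 v).map (fun x i => a i + x i) =
      (Measure.pi fun _ : Fin d => gaussianReal 0 v).withDensity fun x => ∏ i, t i (x i) := by
    rw [Measure.pi_map_pi (f := fun (i : Fin d) (x : ℝ) => a i + x)
      fun i => (measurable_const_add (a i)).aemeasurable]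
    refine Measure.pi_eq fun s hs => ?_
    rw [withDensity_apply _ (MeasurableSet.univ_pi hs),
      ← lintegral_indicator (MeasurableSet.univ_pi hs)]
    have h1 : ∀ x : Fin d → ℝ, (Set.univ.pi s).indicator (fun x => ∏ i, t i (x i)) x =
        ∏ i, (s i).indicator (t i) (x i) := by
      intro x
      by_cases hx : x ∈ Set.univ.pi s
      · rw [Set.indicator_of_mem hx]
        exact Finset.prod_congr rfl fun i _ => (Set.indicator_of_mem (hx i trivial) _).symm
      · rw [Set.indicator_of_notMem hx]
        simp only [Set.mem_pi, Set.mem_univ, true_implies, not_forall] at hx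
        obtain ⟨i, hi⟩ := hx
        exact (Finset.prod_eq_zero (Finset.mem_univ i) (Set.indicator_of_notMem hi _)).symm
    simp only [h1]
    rw [lintegral_prod_pi_eq_prod _ _ fun i => (htm i).indicator (hs i)]
    refine Finset.prod_congr rfl fun i _ => ?_
    rw [gaussianReal_map_add_eq_withDensity hv0, withDensity_apply _ (hs i),
      lintegral_indicator (hs i)]
  have hm : Measurable (WithLp.toLp 2 : (Fin d → ℝ) → EuclideanSpace ℝ (Fin d)) := by fun_prop
  rw [gaussianNoise, lintegral_map (by fun_prop) hm,
    lintegral_map (f := fun x => ENNReal.ofReal (gaussianTilt (ν ^ 2) a x) * f x)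
      ((measurable_gaussianTilt _ a).ennreal_ofReal.mul hf) hm]
  simp only [hprod]
  have h2 := lintegral_withDensity_eq_lintegral_mul (Measure.pi fun _ : Fin d => gaussianReal 0 v)
    (f := fun x : Fin d → ℝ => ∏ i, t i (x i)) (by fun_prop)
    (g := fun x => f (WithLp.toLp 2 x)) (hf.comp hm)
  rw [← hpi, lintegral_map (f := fun x : Fin d → ℝ => f (WithLp.toLp 2 x)) (hf.comp hm)
    (by fun_prop)] at h2
  exact h2

lemma lintegral_gaussianTilt {d : ℕ} {ν : ℝ} (hν : ν ≠ 0) (a : EuclideanSpace ℝ (Fin d)) :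
    ∫⁻ x, ENNReal.ofReal (gaussianTilt (ν ^ 2) a x) ∂(gaussianNoise d ν) = 1 := by
  simpa using (lintegral_add_gaussianNoise hν a (measurable_const (a := (1 : ℝ≥0∞)))).symm

lemma integrable_gaussianTilt {d : ℕ} {ν : ℝ} (hν : ν ≠ 0) (a : EuclideanSpace ℝ (Fin d)) :
    Integrable (gaussianTilt (ν ^ 2) a) (gaussianNoise d ν) := by
  refine ⟨(measurable_gaussianTilt _ a).aestronglyMeasurable, ?_⟩
  rw [hasFiniteIntegral_iff_ofReal (ae_of_all _ fun x => (gaussianTilt_pos _ a x).le),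
    lintegral_gaussianTilt hν]
  exact ENNReal.one_lt_top

lemma integral_gaussianTilt {d : ℕ} {ν : ℝ} (hν : ν ≠ 0) (a : EuclideanSpace ℝ (Fin d)) :
    ∫ x, gaussianTilt (ν ^ 2) a x ∂(gaussianNoise d ν) = 1 := by
  rw [integral_eq_lintegral_of_nonneg_ae (ae_of_all _ fun x => (gaussianTilt_pos _ a x).le)
    (measurable_gaussianTilt _ a).aestronglyMeasurable, lintegral_gaussianTilt hν]
  rfl

lemma gaussianTilt_rpow_mul_rpow {d : ℕ} (v r s : ℝ) (a b x : EuclideanSpace ℝ (Fin d)) :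
    gaussianTilt v a x ^ r * gaussianTilt v b x ^ s =
      Real.exp ((‖r • a + s • b‖ ^ 2 - r * ‖a‖ ^ 2 - s * ‖b‖ ^ 2) / (2 * v)) *
        gaussianTilt v (r • a + s • b) x := by
  simp only [gaussianTilt, ← Real.exp_mul, ← Real.exp_add, inner_add_left, real_inner_smul_left]
  congr 1
  ring

lemma integrable_gaussianTilt_rpow_mul_rpow {d : ℕ} {ν : ℝ} (hν : ν ≠ 0) (r s : ℝ)
    (a b : EuclideanSpace ℝ (Fin d)) :
    Integrable (fun x => gaussianTilt (ν ^ 2) a x ^ r * gaussianTilt (ν ^ 2) b x ^ s)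
      (gaussianNoise d ν) := by
  simp only [gaussianTilt_rpow_mul_rpow]
  exact (integrable_gaussianTilt hν _).const_mul _

lemma integral_gaussianTilt_rpow_mul_rpow {d : ℕ} {ν : ℝ} (hν : ν ≠ 0) (r s : ℝ)
    (a b : EuclideanSpace ℝ (Fin d)) :
    ∫ x, gaussianTilt (ν ^ 2) a x ^ r * gaussianTilt (ν ^ 2) b x ^ s ∂(gaussianNoise d ν) =
      Real.exp ((‖r • a + s • b‖ ^ 2 - r * ‖a‖ ^ 2 - s * ‖b‖ ^ 2) / (2 * ν ^ 2)) := by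
  simp only [gaussianTilt_rpow_mul_rpow, integral_const_mul, integral_gaussianTilt hν, mul_one]

/-! ### Expansions of powers to second order -/

/-- The bound `(1 + x) ^ α ≤ 1 + α x + A x² + B x₊ ^ n` for all `x ≥ -1`. -/
def PowerExpansion (α A B n : ℝ) : Prop :=
  ∀ x : ℝ, -1 ≤ x → (1 + x) ^ α ≤ 1 + α * x + A * x ^ 2 + B * max x 0 ^ n

lemma powerExpansion_of_le_two {α : ℝ} (h1 : 1 < α) (h2 : α ≤ 2) :
    PowerExpansion α (α - 1) 0 2 := by
  intro x hx
  rcases eq_or_lt_of_le hx with rfl | hx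
  · rw [add_neg_cancel, Real.zero_rpow (by linarith)]
    linarith
  have hx0 : 0 < 1 + x := by linarith
  have h3 := rpow_one_add_le_one_add_mul_self hx.le (p := α - 1) (by linarith) (by linarith)
  calc (1 + x) ^ α = (1 + x) * (1 + x) ^ (α - 1) := by
        rw [Real.rpow_sub_one hx0.ne']; field_simp
    _ ≤ (1 + x) * (1 + (α - 1) * x) := by gcongr
    _ = _ := by ring

lemma powerExpansion_of_le_three {α : ℝ} (h1 : 2 ≤ α) (h2 : α ≤ 3) :
    PowerExpansion α (1 + 2 * (α - 2)) (α - 2) 3 := by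
  intro x hx
  rcases eq_or_lt_of_le hx with rfl | hx
  · rw [add_neg_cancel, Real.zero_rpow (by linarith)]
    norm_num
    linarith
  have hx0 : 0 < 1 + x := by linarith
  have h3 := rpow_one_add_le_one_add_mul_self hx.le (p := α - 2) (by linarith) (by linarith)
  have h4 : x ^ 3 ≤ max x 0 ^ (3 : ℝ) := by
    rw [show (3 : ℝ) = (3 : ℕ) by norm_num, Real.rpow_natCast]
    exact (Odd.strictMono_pow (by decide : Odd 3)).monotone (le_max_left _ _)
  calc (1 + x) ^ α = (1 + x) ^ 2 * (1 + x) ^ (α - 2) := by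
        rw [← Real.rpow_natCast, ← Real.rpow_add hx0]; norm_num
    _ ≤ (1 + x) ^ 2 * (1 + (α - 2) * x) := by gcongr
    _ = 1 + α * x + (1 + 2 * (α - 2)) * x ^ 2 + (α - 2) * x ^ 3 := by ring
    _ ≤ _ := by
        have : 0 ≤ α - 2 := by linarith
        gcongr

/-- Bernoulli's inequality at the other endpoint. -/
lemma one_add_rpow_le_one_add_mul {a x : ℝ} (ha : 1 ≤ a) (hx : 0 ≤ x) :
    (1 + x) ^ a ≤ 1 + a * x * (1 + x) ^ (a - 1) := by
  have hx0 : 0 < 1 + x := by linarith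
  have h := one_add_mul_self_le_rpow_one_add (s := (1 + x)⁻¹ - 1) (p := a)
    (by have := inv_pos.2 hx0; linarith) ha
  rw [add_sub_cancel, Real.inv_rpow hx0.le] at h
  have h2 : 0 < (1 + x) ^ a := Real.rpow_pos_of_pos hx0 _
  have h3 := mul_le_mul_of_nonneg_right h h2.le
  rw [inv_mul_cancel₀ h2.ne'] at h3
  rw [Real.rpow_sub_one hx0.ne']
  have h4 : (1 + a * ((1 + x)⁻¹ - 1)) * (1 + x) ^ a =
      (1 + x) ^ a - a * x * ((1 + x) ^ a / (1 + x)) := by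
    field_simp
    ring
  linarith

/-- Second-order Taylor expansion of `(1 + x) ^ α`, with the Lagrange form of the remainder. -/
lemma one_add_rpow_le_taylor {α x : ℝ} (hα : 2 ≤ α) (hx : -1 ≤ x) :
    (1 + x) ^ α ≤ 1 + α * x + α * (α - 1) / 2 * x ^ 2 * (1 + max x 0) ^ (α - 2) := by
  set M := (1 + max x 0) ^ (α - 2) with hM
  set h : ℝ → ℝ := fun y => 1 + α * y + α * (α - 1) / 2 * y ^ 2 * M - (1 + y) ^ α with hh
  have hd : ∀ y, HasDerivAt h (α * (1 + (α - 1) * y * M - (1 + y) ^ (α - 1))) y := by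
    intro y
    have e1 : HasDerivAt (fun y : ℝ => (1 + y) ^ α) (1 * α * (1 + y) ^ (α - 1)) y :=
      ((hasDerivAt_id y).const_add 1).rpow_const (Or.inr (by linarith))
    have e2 : HasDerivAt (fun y : ℝ => 1 + α * y + α * (α - 1) / 2 * y ^ 2 * M)
        (α * 1 + α * (α - 1) / 2 * ((2 : ℕ) * y ^ (2 - 1)) * M) y :=
      (((hasDerivAt_id y).const_mul α).const_add 1).add
        (((hasDerivAt_pow 2 y).const_mul (α * (α - 1) / 2)).mul_const M)
    refine (e2.sub e1).congr_deriv ?_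
    push_cast
    ring
  have hc : Continuous h := continuous_iff_continuousAt.2 fun y => (hd y).continuousAt
  have h0 : h 0 = 0 := by simp [hh]
  suffices h 0 ≤ h x by
    rw [h0] at this
    simp only [hh] at this
    linarith
  rcases le_total 0 x with hx0 | hx0
  · have hmono : MonotoneOn h (Set.Icc 0 x) := by
      refine monotoneOn_of_deriv_nonneg (convex_Icc 0 x) hc.continuousOn
        (fun y _ => (hd y).differentiableAt.differentiableWithinAt) fun y hy => ?_
      rw [interior_Icc] at hy
      rw [(hd y).deriv]
      have h1 := one_add_rpow_le_one_add_mul (a := α - 1) (by linarith) hy.1.le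
      have h2 : (1 + y) ^ (α - 1 - 1) ≤ M := by
        rw [hM, max_eq_left hx0, show α - 1 - 1 = α - 2 by ring]
        exact Real.rpow_le_rpow (by linarith [hy.1]) (by linarith [hy.2]) (by linarith)
      have h3 : (α - 1) * y * (1 + y) ^ (α - 1 - 1) ≤ (α - 1) * y * M :=
        mul_le_mul_of_nonneg_left h2 (mul_nonneg (by linarith) hy.1.le)
      exact mul_nonneg (by linarith) (by linarith)
    exact hmono ⟨le_rfl, hx0⟩ ⟨hx0, le_rfl⟩ hx0
  · have hM1 : M = 1 := by rw [hM, max_eq_right hx0, add_zero, Real.one_rpow]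
    have hanti : AntitoneOn h (Set.Icc x 0) := by
      refine antitoneOn_of_deriv_nonpos (convex_Icc x 0) hc.continuousOn
        (fun y _ => (hd y).differentiableAt.differentiableWithinAt) fun y hy => ?_
      rw [interior_Icc] at hy
      rw [(hd y).deriv, hM1]
      have h1 := one_add_mul_self_le_rpow_one_add (s := y) (p := α - 1) (by linarith [hy.1])
        (by linarith)
      exact mul_nonpos_of_nonneg_of_nonpos (by linarith) (by linarith)
    exact hanti ⟨le_rfl, hx0⟩ ⟨hx0, le_rfl⟩ hx0

/-- Convexity of `x ↦ x ^ m`, applied to the convex combination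
`1 + z = (1 - θ) * (1 - θ)⁻¹ + θ * (z / θ)`. -/
lemma one_add_rpow_le_add_rpow {m θ z : ℝ} (hm : 1 ≤ m) (hθ0 : 0 < θ) (hθ1 : θ < 1)
    (hz : 0 ≤ z) :
    (1 + z) ^ m ≤ (1 - θ) ^ (1 - m) + θ ^ (1 - m) * z ^ m := by
  have hθ' : 0 < 1 - θ := by linarith
  have h := (convexOn_rpow hm).2 (Set.mem_Ici.2 (inv_pos.2 hθ').le)
    (Set.mem_Ici.2 (div_nonneg hz hθ0.le)) hθ'.le hθ0.le (by ring)
  simp only [smul_eq_mul] at h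
  rw [mul_inv_cancel₀ hθ'.ne', mul_div_cancel₀ z hθ0.ne', Real.inv_rpow hθ'.le,
    Real.div_rpow hz hθ0.le] at h
  refine h.trans (le_of_eq ?_)
  rw [Real.rpow_sub hθ', Real.rpow_sub hθ0, Real.rpow_one, Real.rpow_one]
  field_simp

lemma powerExpansion_of_three_le {α : ℝ} (hα : 3 ≤ α) :
    PowerExpansion α (α * (α - 1) / 2 * Real.exp (1 / 2))
      (α * (α - 1) / 2 * (1 / (2 * (α - 1))) ^ (3 - α)) α := by
  intro x hx
  have hα1 : 0 < α - 1 := by linarith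
  set θ := 1 / (2 * (α - 1)) with hθ
  have hθ0 : 0 < θ := by positivity
  have hθ1 : θ ≤ 1 / 4 := by
    rw [hθ]
    exact one_div_le_one_div_of_le (by norm_num) (by linarith)
  have hθ' : 0 < 1 - θ := by linarith
  have h1 := one_add_rpow_le_add_rpow (m := α - 2) (by linarith) hθ0 (by linarith)
    (le_max_right x 0)
  rw [show 1 - (α - 2) = 3 - α by ring] at h1
  have h2 : (1 - θ) ^ (3 - α) ≤ Real.exp (1 / 2) := by
    rw [Real.rpow_def_of_pos hθ']
    refine Real.exp_le_exp.2 ?_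
    have h3 : -Real.log (1 - θ) ≤ (1 - θ)⁻¹ - 1 := by
      rw [← Real.log_inv]
      exact Real.log_le_sub_one_of_pos (inv_pos.2 hθ')
    have h4 : (1 - θ)⁻¹ - 1 = 1 / (2 * α - 3) := by
      have : 2 * α - 3 ≠ 0 := by linarith
      have e : 1 - θ = (2 * α - 3) / (2 * (α - 1)) := by rw [hθ]; field_simp; ring
      rw [e]
      field_simp
      ring
    calc Real.log (1 - θ) * (3 - α) = -Real.log (1 - θ) * (α - 3) := by ring
      _ ≤ 1 / (2 * α - 3) * (α - 3) := by
        rw [← h4]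
        exact mul_le_mul_of_nonneg_right h3 (by linarith)
      _ ≤ 1 / 2 := by
        rw [one_div_mul_eq_div, div_le_div_iff₀ (by linarith) (by norm_num)]
        linarith
  have h5 : x ^ 2 * max x 0 ^ (α - 2) = max x 0 ^ α := by
    rcases le_total x 0 with hx0 | hx0
    · rw [max_eq_right hx0, Real.zero_rpow (by linarith), Real.zero_rpow (by linarith), mul_zero]
    · rw [max_eq_left hx0]
      rcases eq_or_lt_of_le hx0 with rfl | hx0
      · rw [Real.zero_rpow (by linarith), Real.zero_rpow (by linarith), mul_zero]
      · rw [← Real.rpow_natCast, ← Real.rpow_add hx0]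
        norm_num
  have h6 : 0 ≤ α * (α - 1) / 2 := by
    have : 0 ≤ α := by linarith
    positivity
  calc (1 + x) ^ α
      ≤ 1 + α * x + α * (α - 1) / 2 * x ^ 2 * (1 + max x 0) ^ (α - 2) :=
        one_add_rpow_le_taylor (by linarith) hx
    _ ≤ 1 + α * x + α * (α - 1) / 2 * x ^ 2 *
          (Real.exp (1 / 2) + θ ^ (3 - α) * max x 0 ^ (α - 2)) := by
        gcongr
        exact h1.trans (by gcongr)
    _ = 1 + α * x + α * (α - 1) / 2 * Real.exp (1 / 2) * x ^ 2 +
          α * (α - 1) / 2 * θ ^ (3 - α) * (x ^ 2 * max x 0 ^ (α - 2)) := by ring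
    _ = _ := by rw [h5]

/-! ### The privacy cost of one round -/

/-- A bound for the constant `2 (e ^ s - e ^ (s / 2))` governing the second-order term. -/
lemma two_mul_exp_sub_exp_half_le {s : ℝ} (hs0 : 0 ≤ s) (hs : s ≤ 3 / 2) :
    2 * (Real.exp s - Real.exp (s / 2)) ≤ 3.2 * s := by
  have h34 : Real.exp (3 / 4) ≤ 2.12 := by
    have h := Real.exp_one_lt_d9
    have h1 : Real.exp (3 / 4) ^ 4 = Real.exp 1 ^ 3 := by
      rw [← Real.exp_nat_mul, ← Real.exp_nat_mul]
      norm_num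
    by_contra! hc
    have h2 : (2.12 : ℝ) ^ 4 < Real.exp (3 / 4) ^ 4 := by gcongr
    have h3 : Real.exp 1 ^ 3 ≤ (2.7182818286 : ℝ) ^ 3 := by gcongr
    have h4 : (2.7182818286 : ℝ) ^ 3 < 2.12 ^ 4 := by norm_num
    linarith
  -- the chord of `exp` over `[0, 3 / 4]`
  have hch : Real.exp (s / 2) ≤ 1 + 2 * s / 3 * 1.12 := by
    have h := convexOn_exp.2 (Set.mem_univ 0) (Set.mem_univ (3 / 4))
      (by linarith : 0 ≤ 1 - 2 * s / 3) (by linarith : 0 ≤ 2 * s / 3) (by ring)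
    simp only [smul_eq_mul, mul_zero, zero_add, Real.exp_zero, mul_one] at h
    rw [show 2 * s / 3 * (3 / 4) = s / 2 by ring] at h
    nlinarith
  have h1 : Real.exp (s / 2) ≤ 2.12 := (Real.exp_le_exp.2 (by linarith)).trans h34
  have h2 : Real.exp s = Real.exp (s / 2) * Real.exp (s / 2) := by rw [← Real.exp_add]; ring_nf
  have h3 : 1 ≤ Real.exp (s / 2) := Real.one_le_exp (by linarith)
  rw [h2]
  nlinarith [mul_le_mul h1 (sub_le_sub_right hch 1) (by linarith) (by norm_num)]

/-- The expansions of `(1 + x) ^ α` are precise enough: with `s` the squared ratio of sensitivity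
and noise level, the second- and higher-order terms of the moment of the privacy loss stay below
`α - 1` times the privacy cost `7 / 2 * τ ^ 2 * α * s`. -/
lemma exists_powerExpansion {α τ s : ℝ} (hα : 1 < α) (hτ : 0 < τ) (hs0 : 0 < s) (hs : s ≤ 3 / 2)
    (h : τ * α * (1 + 1 / s) * Real.exp (3 / 2 * s * (α - 1)) ≤ 1) :
    ∃ A B n, 0 ≤ A ∧ 0 ≤ B ∧ 2 ≤ n ∧ PowerExpansion α A B n ∧
      A * (τ ^ 2 * (3.2 * s)) + B * (τ ^ n * Real.exp (n * (n - 1) / 2 * s)) ≤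
        (α - 1) * (7 / 2 * τ ^ 2 * α * s) := by
  have hτs : 0 < τ ^ 2 * s := by positivity
  have hα0 : 0 < α := by linarith
  have hκ : τ * α * Real.exp (3 / 2 * s * (α - 1)) ≤ s / (1 + s) := by
    rw [le_div_iff₀ (by linarith)]
    have e : τ * α * Real.exp (3 / 2 * s * (α - 1)) * (1 + s) =
        s * (τ * α * (1 + 1 / s) * Real.exp (3 / 2 * s * (α - 1))) := by
      field_simp
      ring
    rw [e]
    exact mul_le_of_le_one_right hs0.le h
  rcases le_total α 2 with h2 | h2
  · refine ⟨α - 1, 0, 2, by linarith, le_rfl, le_rfl, powerExpansion_of_le_two hα h2, ?_⟩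
    have : 0 < (α - 1) * (τ ^ 2 * s) := mul_pos (by linarith) hτs
    nlinarith
  rcases le_total α 3 with h3 | h3
  · refine ⟨1 + 2 * (α - 2), α - 2, 3, by linarith, by linarith, by norm_num,
      powerExpansion_of_le_three h2 h3, ?_⟩
    rw [show (3 : ℝ) * (3 - 1) / 2 * s = 3 / 2 * s + 3 / 2 * s by ring, Real.exp_add,
      show τ ^ (3 : ℝ) = τ ^ 2 * τ by
        rw [show (3 : ℝ) = (3 : ℕ) by norm_num, Real.rpow_natCast]; ring]
    have hle : Real.exp (3 / 2 * s) ≤ Real.exp (3 / 2 * s * (α - 1)) :=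
      Real.exp_le_exp.2 (by nlinarith)
    -- the chord of `exp` over `[0, 9 / 4]`
    have hch : Real.exp (3 / 2 * s) ≤ 6 * (1 + s) := by
      have h94 : Real.exp (9 / 4) ≤ 10 := by
        have h4 : Real.exp (9 / 4) ^ 4 = Real.exp 1 ^ 9 := by
          rw [← Real.exp_nat_mul, ← Real.exp_nat_mul]
          norm_num
        by_contra! hc
        have h5 : (10 : ℝ) ^ 4 < Real.exp (9 / 4) ^ 4 := by gcongr
        have h6 : Real.exp 1 ^ 9 ≤ (2.7182818286 : ℝ) ^ 9 := by
          have := Real.exp_one_lt_d9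
          gcongr
        have h7 : (2.7182818286 : ℝ) ^ 9 < 10 ^ 4 := by norm_num
        linarith
      have h := convexOn_exp.2 (Set.mem_univ 0) (Set.mem_univ (9 / 4))
        (by linarith : 0 ≤ 1 - 2 * s / 3) (by linarith : 0 ≤ 2 * s / 3) (by ring)
      simp only [smul_eq_mul, mul_zero, zero_add, Real.exp_zero, mul_one] at h
      rw [show 2 * s / 3 * (9 / 4) = 3 / 2 * s by ring] at h
      nlinarith
    have h4 : τ * Real.exp (3 / 2 * s) * Real.exp (3 / 2 * s) ≤ 3 * s := by
      have h5 : τ * Real.exp (3 / 2 * s) ≤ s / (1 + s) / 2 := by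
        rw [le_div_iff₀ two_pos]
        calc τ * Real.exp (3 / 2 * s) * 2 = τ * 2 * Real.exp (3 / 2 * s) := by ring
          _ ≤ τ * α * Real.exp (3 / 2 * s * (α - 1)) := by gcongr
          _ ≤ _ := hκ
      calc _ ≤ s / (1 + s) / 2 * (6 * (1 + s)) := by gcongr
        _ = 3 * s := by field_simp; ring
    calc _ = (1 + 2 * (α - 2)) * 3.2 * (τ ^ 2 * s) +
          (α - 2) * τ ^ 2 * (τ * Real.exp (3 / 2 * s) * Real.exp (3 / 2 * s)) := by ring
      _ ≤ (1 + 2 * (α - 2)) * 3.2 * (τ ^ 2 * s) + (α - 2) * τ ^ 2 * (3 * s) := by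
        have : 0 ≤ α - 2 := by linarith
        gcongr
      _ = ((1 + 2 * (α - 2)) * 3.2 + (α - 2) * 3) * (τ ^ 2 * s) := by ring
      _ ≤ ((α - 1) * (7 / 2 * α)) * (τ ^ 2 * s) := by
        gcongr
        nlinarith
      _ = _ := by ring
  · have hα1 : 0 < α - 1 := by linarith
    refine ⟨_, _, α, ?_, ?_, h2, powerExpansion_of_three_le h3, ?_⟩
    · positivity
    · positivity
    set θ := 1 / (2 * (α - 1)) with hθ
    have hθ0 : 0 < θ := by positivity
    have hθ1 : θ ≤ 1 / 4 := by
      rw [hθ]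
      exact one_div_le_one_div_of_le (by norm_num) (by linarith)
    have hexp : Real.exp (1 / 2) ≤ 1.65 := by
      have h4 : Real.exp (1 / 2) ^ 2 = Real.exp 1 := by
        rw [← Real.exp_nat_mul]
        norm_num
      have := Real.exp_one_lt_d9
      have := Real.exp_pos (1 / 2)
      nlinarith
    set ξ := τ / θ * Real.exp (3 / 2 * s * (α - 1)) with hξ
    have hξ0 : 0 < ξ := by positivity
    have hξ1 : ξ ≤ 2 * s := by
      have e : τ / θ = 2 * (τ * (α - 1)) := by rw [hθ]; field_simp
      calc ξ = 2 * (τ * (α - 1) * Real.exp (3 / 2 * s * (α - 1))) := by rw [hξ, e]; ring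
        _ ≤ 2 * (τ * α * Real.exp (3 / 2 * s * (α - 1))) := by gcongr; linarith
        _ ≤ 2 * (s / (1 + s)) := by gcongr
        _ ≤ 2 * s := by gcongr; exact div_le_self hs0.le (by linarith)
    -- the higher-order term is geometrically small, thanks to the condition on `α`
    have hhigh : (τ / θ) ^ (α - 2) * Real.exp (α * (α - 1) / 2 * s) ≤ 2 * s := by
      have e1 : τ / θ = ξ * Real.exp (-(3 / 2 * s * (α - 1))) := by
        rw [hξ, mul_assoc, ← Real.exp_add, add_neg_cancel, Real.exp_zero, mul_one]
      have e2 : (τ / θ) ^ (α - 2) * Real.exp (α * (α - 1) / 2 * s) =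
          ξ * (ξ * Real.exp (-(s * (α - 1)))) ^ (α - 3) := by
        rw [e1, Real.mul_rpow hξ0.le (Real.exp_pos _).le,
          Real.mul_rpow hξ0.le (Real.exp_pos _).le, ← Real.exp_mul, ← Real.exp_mul, mul_assoc,
          ← Real.exp_add, ← mul_assoc, mul_comm ξ, ← Real.rpow_add_one hξ0.ne']
        ring_nf
      rw [e2]
      refine (mul_le_of_le_one_right hξ0.le ?_).trans hξ1
      refine Real.rpow_le_one (by positivity) ?_ (by linarith)
      rw [Real.exp_neg, ← div_eq_mul_inv, div_le_one (Real.exp_pos _)]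
      have h5 := Real.add_one_le_exp (s * (α - 1))
      nlinarith
    have e3 : θ ^ (3 - α) * (τ ^ α * Real.exp (α * (α - 1) / 2 * s)) =
        τ ^ 2 * θ * ((τ / θ) ^ (α - 2) * Real.exp (α * (α - 1) / 2 * s)) := by
      have e4 : τ ^ α = τ ^ 2 * τ ^ (α - 2) := by
        rw [← Real.rpow_natCast, ← Real.rpow_add hτ]
        norm_num
      have e5 : θ ^ (3 - α) = θ / θ ^ (α - 2) := by
        rw [show 3 - α = 1 - (α - 2) by ring, Real.rpow_sub hθ0, Real.rpow_one]
      rw [e4, e5, Real.div_rpow hτ.le hθ0.le]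
      ring
    calc _ = α * (α - 1) / 2 * (Real.exp (1 / 2) * 3.2 * (τ ^ 2 * s) +
          θ ^ (3 - α) * (τ ^ α * Real.exp (α * (α - 1) / 2 * s))) := by ring
      _ ≤ α * (α - 1) / 2 * (1.65 * 3.2 * (τ ^ 2 * s) + τ ^ 2 * (1 / 4) * (2 * s)) := by
        rw [e3]
        gcongr
      _ = α * (α - 1) * (τ ^ 2 * s) * 2.89 := by ring
      _ ≤ α * (α - 1) * (τ ^ 2 * s) * (7 / 2) := by gcongr; norm_num
      _ = _ := by ring

/-! ### Mixtures of Gaussians with a common component -/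

/-- Convexity of `y ↦ y ^ r` for `r ≤ 0`. -/
lemma mixture_rpow_le {τ y r : ℝ} (hτ0 : 0 ≤ τ) (hτ1 : τ ≤ 1) (hy : 0 < y) (hr : r ≤ 0) :
    (1 - τ + τ * y) ^ r ≤ 1 - τ + τ * y ^ r := by
  have h1 := Real.geom_mean_le_arith_mean2_weighted (sub_nonneg.2 hτ1) hτ0 zero_le_one hy.le
    (by ring)
  have h2 := Real.geom_mean_le_arith_mean2_weighted (sub_nonneg.2 hτ1) hτ0 zero_le_one
    (Real.rpow_pos_of_pos hy r).le (by ring)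
  simp only [Real.one_rpow, one_mul, mul_one] at h1 h2
  calc (1 - τ + τ * y) ^ r ≤ (y ^ τ) ^ r :=
        Real.rpow_le_rpow_of_nonpos (Real.rpow_pos_of_pos hy τ) h1 hr
    _ = (y ^ r) ^ τ := by rw [← Real.rpow_mul hy.le, ← Real.rpow_mul hy.le, mul_comm]
    _ ≤ _ := h2

/-- Pointwise bound of the integrand of the Rényi moment of `1 - τ + τ P` relative to
`1 - τ + τ Q`: the expansion of `(1 + x) ^ α` at `x = τ (P - Q) / (1 - τ + τ Q)`, in which the
negative powers of `1 - τ + τ Q` are bounded by convexity. -/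
lemma mixture_rpow_mul_rpow_le {α A B n τ P Q : ℝ} (hA : 0 ≤ A) (hB : 0 ≤ B) (hn : 2 ≤ n)
    (h : PowerExpansion α A B n) (hτ0 : 0 < τ) (hτ1 : τ < 1) (hP : 0 < P) (hQ : 0 < Q) :
    (1 - τ + τ * P) ^ α * (1 - τ + τ * Q) ^ (1 - α) ≤
      1 - τ + τ * Q + α * (τ * (P - Q)) +
        A * (τ ^ 2 * ((1 - τ) * (P - Q) ^ 2 + τ * ((P - Q) ^ 2 * Q ^ (-1 : ℝ)))) +
        B * (τ ^ n * ((1 - τ) * P ^ n + τ * (P ^ n * Q ^ (1 - n)))) := by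
  have hτ' : 0 < 1 - τ := by linarith
  set p := 1 - τ + τ * P with hp
  set q := 1 - τ + τ * Q with hq
  have hp0 : 0 < p := by positivity
  have hq0 : 0 < q := by positivity
  have hx : 1 + τ * (P - Q) / q = p / q := by
    rw [hp, hq] at *
    field_simp
    ring
  have h1 := h (τ * (P - Q) / q) (by have := div_pos hp0 hq0; linarith)
  rw [hx] at h1
  have h2 : max (τ * (P - Q) / q) 0 ≤ τ * P / q := by
    refine max_le ?_ (by positivity)
    gcongr
    linarith
  have h3 : max (τ * (P - Q) / q) 0 ^ n ≤ (τ * P / q) ^ n :=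
    Real.rpow_le_rpow (le_max_right _ _) h2 (by linarith)
  have h4 : q * (τ * P / q) ^ n = τ ^ n * (P ^ n * q ^ (1 - n)) := by
    rw [Real.div_rpow (by positivity) hq0.le, Real.mul_rpow hτ0.le hP.le, Real.rpow_sub hq0,
      Real.rpow_one]
    ring
  have h5 : q ^ (-1 : ℝ) ≤ 1 - τ + τ * Q ^ (-1 : ℝ) :=
    mixture_rpow_le hτ0.le hτ1.le hQ (by norm_num)
  have h6 : q ^ (1 - n) ≤ 1 - τ + τ * Q ^ (1 - n) :=
    mixture_rpow_le hτ0.le hτ1.le hQ (by linarith)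
  calc p ^ α * q ^ (1 - α) = q * (p / q) ^ α := by
        rw [Real.div_rpow hp0.le hq0.le, Real.rpow_sub hq0, Real.rpow_one]
        ring
    _ ≤ q * (1 + α * (τ * (P - Q) / q) + A * (τ * (P - Q) / q) ^ 2 + B * (τ * P / q) ^ n) := by
        gcongr
        exact h1.trans (by gcongr)
    _ = q + α * (τ * (P - Q)) + A * (τ ^ 2 * ((P - Q) ^ 2 * q ^ (-1 : ℝ))) +
          B * (q * (τ * P / q) ^ n) := by
        rw [Real.rpow_neg_one]
        field_simp
    _ ≤ q + α * (τ * (P - Q)) + A * (τ ^ 2 * ((P - Q) ^ 2 * (1 - τ + τ * Q ^ (-1 : ℝ)))) +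
          B * (τ ^ n * (P ^ n * (1 - τ + τ * Q ^ (1 - n)))) := by
        rw [h4]
        gcongr
    _ = _ := by ring

section Mixture

variable {d : ℕ} {ν : ℝ}

/-- The second-order term for three Gaussians at mutual distance at most `√s ν`. -/
lemma exp_add_exp_sub_le {s : ℝ} (hν : ν ≠ 0) (hs0 : 0 ≤ s) (hs : s ≤ 3 / 2)
    {a b : EuclideanSpace ℝ (Fin d)} (ha : ‖a‖ ^ 2 ≤ s * ν ^ 2) (hb : ‖b‖ ^ 2 ≤ s * ν ^ 2)
    (hab : ‖a - b‖ ^ 2 ≤ s * ν ^ 2) :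
    Real.exp (‖a‖ ^ 2 / ν ^ 2) + Real.exp (‖b‖ ^ 2 / ν ^ 2)
      - 2 * Real.exp (inner ℝ a b / ν ^ 2) ≤ 3.2 * s := by
  have hν2 : 0 < ν ^ 2 := by positivity
  set X := Real.exp (‖a‖ ^ 2 / ν ^ 2 / 2) with hX
  set Y := Real.exp (‖b‖ ^ 2 / ν ^ 2 / 2) with hY
  set E := Real.exp (s / 2) with hE
  have hX1 : 1 ≤ X := Real.one_le_exp (by positivity)
  have hY1 : 1 ≤ Y := Real.one_le_exp (by positivity)
  have hXE : X ≤ E := Real.exp_le_exp.2 (by gcongr; rwa [div_le_iff₀ hν2])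
  have hYE : Y ≤ E := Real.exp_le_exp.2 (by gcongr; rwa [div_le_iff₀ hν2])
  have hE0 : 0 < E := Real.exp_pos _
  have e1 : Real.exp (‖a‖ ^ 2 / ν ^ 2) = X * X := by rw [hX, ← Real.exp_add]; ring_nf
  have e2 : Real.exp (‖b‖ ^ 2 / ν ^ 2) = Y * Y := by rw [hY, ← Real.exp_add]; ring_nf
  have e3 : Real.exp s = E * E := by rw [hE, ← Real.exp_add]; ring_nf
  have h1 : X * Y ≤ E * Real.exp (inner ℝ a b / ν ^ 2) := by
    rw [hX, hY, hE, ← Real.exp_add, ← Real.exp_add]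
    refine Real.exp_le_exp.2 ?_
    have h2 := norm_sub_sq_real a b
    have h3 : (‖a‖ ^ 2 + ‖b‖ ^ 2) / ν ^ 2 ≤ s + 2 * inner ℝ a b / ν ^ 2 := by
      rw [div_le_iff₀ hν2, add_mul, div_mul_cancel₀ _ hν2.ne']
      linarith
    rw [add_div, mul_div_assoc] at h3
    linarith
  have h4 := two_mul_exp_sub_exp_half_le hs0 hs
  rw [e3] at h4
  rw [e1, e2]
  refine le_trans ?_ h4
  set W := Real.exp (inner ℝ a b / ν ^ 2)
  -- after multiplication by `E`, the left-hand side increases with `X` and with `Y`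
  have h5 : E * (X * X + Y * Y - 2 * W) ≤ E * (2 * (E * E - E)) := by
    have h6 : 0 ≤ (E - X) * (E * (E + X) - 2 * Y) :=
      mul_nonneg (by linarith) (by nlinarith)
    have h7 : 0 ≤ (E - Y) * (E * (E + Y) - 2 * E) :=
      mul_nonneg (by linarith) (by nlinarith)
    nlinarith
  exact le_of_mul_le_mul_left h5 hE0

/-- The Rényi moment of order `α` of two mixtures of Gaussians with a common component. -/
lemma lintegral_mixture_rpow_le {α A B n τ s : ℝ} (hν : ν ≠ 0) (hs0 : 0 ≤ s) (hs : s ≤ 3 / 2)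
    (hA : 0 ≤ A) (hB : 0 ≤ B) (hn : 2 ≤ n) (h : PowerExpansion α A B n)
    (hτ0 : 0 < τ) (hτ1 : τ < 1) {a b : EuclideanSpace ℝ (Fin d)}
    (ha : ‖a‖ ^ 2 ≤ s * ν ^ 2) (hb : ‖b‖ ^ 2 ≤ s * ν ^ 2) (hab : ‖a - b‖ ^ 2 ≤ s * ν ^ 2) :
    ∫⁻ x, ENNReal.ofReal ((1 - τ + τ * gaussianTilt (ν ^ 2) a x) ^ α *
        (1 - τ + τ * gaussianTilt (ν ^ 2) b x) ^ (1 - α)) ∂(gaussianNoise d ν) ≤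
      ENNReal.ofReal
        (1 + (A * (τ ^ 2 * (3.2 * s)) + B * (τ ^ n * Real.exp (n * (n - 1) / 2 * s)))) := by
  have hν2 : 0 < ν ^ 2 := by positivity
  have hτ' : 0 < 1 - τ := by linarith
  set P := gaussianTilt (ν ^ 2) a with hP
  set Q := gaussianTilt (ν ^ 2) b with hQ
  have hP0 : ∀ x, 0 < P x := gaussianTilt_pos _ a
  have hQ0 : ∀ x, 0 < Q x := gaussianTilt_pos _ b
  set M : ℝ → ℝ → EuclideanSpace ℝ (Fin d) → ℝ := fun r t x => P x ^ r * Q x ^ t with hM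
  have hMi : ∀ r t, Integrable (M r t) (gaussianNoise d ν) := fun r t =>
    integrable_gaussianTilt_rpow_mul_rpow hν r t a b
  have hMv : ∀ r t, ∫ x, M r t x ∂(gaussianNoise d ν) =
      Real.exp ((‖r • a + t • b‖ ^ 2 - r * ‖a‖ ^ 2 - t * ‖b‖ ^ 2) / (2 * ν ^ 2)) := fun r t =>
    integral_gaussianTilt_rpow_mul_rpow hν r t a b
  have hexp : ∀ r t, ‖r • a + t • b‖ ^ 2 - r * ‖a‖ ^ 2 - t * ‖b‖ ^ 2 =
      r * (r - 1) * ‖a‖ ^ 2 + t * (t - 1) * ‖b‖ ^ 2 + 2 * (r * t) * inner ℝ a b := by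
    intro r t
    rw [norm_add_sq_real, norm_smul, norm_smul, real_inner_smul_left, real_inner_smul_right,
      mul_pow, mul_pow, Real.norm_eq_abs, Real.norm_eq_abs, sq_abs, sq_abs]
    ring
  have hsub := norm_sub_sq_real a b
  -- the dominating function, as a combination of products of powers of the densities
  set U : EuclideanSpace ℝ (Fin d) → ℝ := fun x =>
    (1 - τ) * M 0 0 x + τ * M 0 1 x + α * (τ * (M 1 0 x - M 0 1 x)) +
      A * (τ ^ 2 * ((1 - τ) * (M 2 0 x + M 0 2 x - 2 * M 1 1 x) +
        τ * (M 2 (-1) x + M 0 1 x - 2 * M 1 0 x))) +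
      B * (τ ^ n * ((1 - τ) * M n 0 x + τ * M n (1 - n) x)) with hU
  have hle : ∀ x, (1 - τ + τ * P x) ^ α * (1 - τ + τ * Q x) ^ (1 - α) ≤ U x := by
    intro x
    refine (mixture_rpow_mul_rpow_le hA hB hn h hτ0 hτ1 (hP0 x) (hQ0 x)).trans (le_of_eq ?_)
    have := (hQ0 x).ne'
    simp only [hU, hM, Real.rpow_zero, Real.rpow_one, Real.rpow_two, Real.rpow_neg_one, mul_one,
      one_mul]
    congr 4
    field_simp
    ring
  have hUi : Integrable U (gaussianNoise d ν) := by
    have := hMi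
    simp only [hU]
    fun_prop
  have hUv : ∫ x, U x ∂(gaussianNoise d ν) ≤
      1 + (A * (τ ^ 2 * (3.2 * s)) + B * (τ ^ n * Real.exp (n * (n - 1) / 2 * s))) := by
    have e00 : ∫ x, M 0 0 x ∂(gaussianNoise d ν) = 1 := by rw [hMv, hexp]; simp
    have e01 : ∫ x, M 0 1 x ∂(gaussianNoise d ν) = 1 := by rw [hMv, hexp]; simp
    have e10 : ∫ x, M 1 0 x ∂(gaussianNoise d ν) = 1 := by rw [hMv, hexp]; simp
    have e20 : ∫ x, M 2 0 x ∂(gaussianNoise d ν) = Real.exp (‖a‖ ^ 2 / ν ^ 2) := by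
      rw [hMv, hexp]; congr 1; field_simp; ring
    have e02 : ∫ x, M 0 2 x ∂(gaussianNoise d ν) = Real.exp (‖b‖ ^ 2 / ν ^ 2) := by
      rw [hMv, hexp]; congr 1; field_simp; ring
    have e11 : ∫ x, M 1 1 x ∂(gaussianNoise d ν) = Real.exp (inner ℝ a b / ν ^ 2) := by
      rw [hMv, hexp]; congr 1; field_simp; ring
    have e21 : ∫ x, M 2 (-1) x ∂(gaussianNoise d ν) = Real.exp (‖a - b‖ ^ 2 / ν ^ 2) := by
      rw [hMv, hexp, hsub]; congr 1; field_simp; ring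
    have hn1 : 0 ≤ n * (n - 1) / 2 := by
      have : 0 ≤ n := by linarith
      have : 0 ≤ n - 1 := by linarith
      positivity
    have en0 : ∫ x, M n 0 x ∂(gaussianNoise d ν) ≤ Real.exp (n * (n - 1) / 2 * s) := by
      rw [hMv, hexp]
      refine Real.exp_le_exp.2 ?_
      rw [div_le_iff₀ (by positivity)]
      nlinarith
    have en1 : ∫ x, M n (1 - n) x ∂(gaussianNoise d ν) ≤ Real.exp (n * (n - 1) / 2 * s) := by
      rw [hMv, hexp]
      refine Real.exp_le_exp.2 ?_
      rw [div_le_iff₀ (by positivity)]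
      have := mul_le_mul_of_nonneg_left hab hn1
      rw [hsub] at this
      linarith
    have h1 := exp_add_exp_sub_le hν hs0 hs ha hb hab
    have h2 : Real.exp (‖a - b‖ ^ 2 / ν ^ 2) + 1 - 2 * 1 ≤ 3.2 * s := by
      have := exp_add_exp_sub_le hν hs0 hs hab
        (b := (0 : EuclideanSpace ℝ (Fin d))) (by simp; positivity) (by simpa using hab)
      simpa using this
    calc ∫ x, U x ∂(gaussianNoise d ν)
        = (1 - τ) * 1 + τ * 1 + α * (τ * (1 - 1)) +
      A * (τ ^ 2 * ((1 - τ) * (Real.exp (‖a‖ ^ 2 / ν ^ 2) + Real.exp (‖b‖ ^ 2 / ν ^ 2)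
          - 2 * Real.exp (inner ℝ a b / ν ^ 2)) +
        τ * (Real.exp (‖a - b‖ ^ 2 / ν ^ 2) + 1 - 2 * 1))) +
      B * (τ ^ n * ((1 - τ) * ∫ x, M n 0 x ∂(gaussianNoise d ν) +
        τ * ∫ x, M n (1 - n) x ∂(gaussianNoise d ν))) := by
          simp only [hU]
          have := hMi
          rw [integral_add, integral_add, integral_add, integral_add, integral_const_mul,
            integral_const_mul, integral_const_mul, integral_const_mul, integral_const_mul,
            integral_const_mul, integral_const_mul, integral_const_mul, integral_sub,
            integral_add, integral_add, integral_const_mul, integral_const_mul, integral_sub,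
            integral_add, integral_sub, integral_add, integral_const_mul, integral_const_mul,
            integral_const_mul, integral_const_mul, e00, e01, e10, e20, e02, e11, e21]
          all_goals fun_prop
      _ ≤ (1 - τ) * 1 + τ * 1 + α * (τ * (1 - 1)) +
      A * (τ ^ 2 * ((1 - τ) * (3.2 * s) + τ * (3.2 * s))) +
      B * (τ ^ n * ((1 - τ) * Real.exp (n * (n - 1) / 2 * s) +
        τ * Real.exp (n * (n - 1) / 2 * s))) := by gcongr
      _ = _ := by ring
  calc _ ≤ ∫⁻ x, ENNReal.ofReal (U x) ∂(gaussianNoise d ν) :=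
        lintegral_mono fun x => ENNReal.ofReal_le_ofReal (hle x)
    _ = ENNReal.ofReal (∫ x, U x ∂(gaussianNoise d ν)) := by
        refine (ofReal_integral_eq_lintegral_ofReal hUi (ae_of_all _ fun x => ?_)).symm
        refine le_trans ?_ (hle x)
        have := hP0 x
        have := hQ0 x
        positivity
    _ ≤ _ := ENNReal.ofReal_le_ofReal hUv

lemma measurable_lintegral_add_gaussianNoise {f : EuclideanSpace ℝ (Fin d) → ℝ≥0∞}
    (hf : Measurable f) : Measurable fun y => ∫⁻ x, f (y + x) ∂(gaussianNoise d ν) :=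
  Measurable.lintegral_prod_right'
    (f := fun z : EuclideanSpace ℝ (Fin d) × EuclideanSpace ℝ (Fin d) => f (z.1 + z.2))
    (hf.comp (measurable_fst.add measurable_snd))

lemma lintegral_mixture {τ : ℝ} (hν : ν ≠ 0) (hτ0 : 0 ≤ τ) (hτ1 : τ ≤ 1)
    (r a : EuclideanSpace ℝ (Fin d)) {f : EuclideanSpace ℝ (Fin d) → ℝ≥0∞} (hf : Measurable f) :
    ENNReal.ofReal (1 - τ) * ∫⁻ x, f (r + x) ∂(gaussianNoise d ν) +
        ENNReal.ofReal τ * ∫⁻ x, f (a + x) ∂(gaussianNoise d ν) =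
      ∫⁻ x, ENNReal.ofReal (1 - τ + τ * gaussianTilt (ν ^ 2) (a - r) x) * f (r + x)
        ∂(gaussianNoise d ν) := by
  have hfr : Measurable fun x => f (r + x) := hf.comp (measurable_const_add r)
  have h1 := lintegral_add_gaussianNoise hν (a - r) hfr
  simp only [← add_assoc, add_sub_cancel] at h1
  have hm := (measurable_gaussianTilt (ν ^ 2) (a - r)).ennreal_ofReal
  rw [h1, ← lintegral_const_mul _ hfr, ← lintegral_const_mul _ (f := fun x =>
      ENNReal.ofReal (gaussianTilt (ν ^ 2) (a - r) x) * f (r + x)) (hm.mul hfr),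
    ← lintegral_add_left (hfr.const_mul _)]
  refine lintegral_congr fun x => ?_
  have hx := (gaussianTilt_pos (ν ^ 2) (a - r) x).le
  rw [ENNReal.ofReal_add (sub_nonneg.2 hτ1) (mul_nonneg hτ0 hx), ENNReal.ofReal_mul hτ0]
  ring

/-- The dual Rényi bound for two mixtures of Gaussians with a common component, from the moment
bound by Hölder's inequality. -/
lemma mixture_le_rpow {α τ s : ℝ} (hν : ν ≠ 0) (hα : 1 < α) (hτ0 : 0 < τ) (hτ1 : τ < 1)
    (hs0 : 0 < s) (hs : s ≤ 3 / 2)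
    (h : τ * α * (1 + 1 / s) * Real.exp (3 / 2 * s * (α - 1)) ≤ 1)
    {r a b : EuclideanSpace ℝ (Fin d)} (ha : ‖a - r‖ ^ 2 ≤ s * ν ^ 2)
    (hb : ‖b - r‖ ^ 2 ≤ s * ν ^ 2) (hab : ‖a - b‖ ^ 2 ≤ s * ν ^ 2)
    {f : EuclideanSpace ℝ (Fin d) → ℝ≥0∞} (hf : Measurable f) :
    ENNReal.ofReal (1 - τ) * ∫⁻ x, f (r + x) ∂(gaussianNoise d ν) +
        ENNReal.ofReal τ * ∫⁻ x, f (a + x) ∂(gaussianNoise d ν) ≤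
      ENNReal.ofReal (Real.exp (7 / 2 * τ ^ 2 * α * s * ((α - 1) / α))) *
        (ENNReal.ofReal (1 - τ) * ∫⁻ x, f (r + x) ^ (α / (α - 1)) ∂(gaussianNoise d ν) +
          ENNReal.ofReal τ * ∫⁻ x, f (b + x) ^ (α / (α - 1)) ∂(gaussianNoise d ν)) ^
            (1 / (α / (α - 1))) := by
  have hα0 : 0 < α := by linarith
  have hα1 : 0 < α - 1 := by linarith
  have hτ' : 0 < 1 - τ := by linarith
  obtain ⟨A, B, n, hA, hB, hn, hexp, hcost⟩ := exists_powerExpansion hα hτ0 hs0 hs h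
  have hF := lintegral_mixture_rpow_le hν hs0.le hs hA hB hn hexp hτ0 hτ1 ha hb
    (by simpa using hab)
  set β := α / (α - 1) with hβ
  have hβ0 : 0 < β := by positivity
  set P := fun x => 1 - τ + τ * gaussianTilt (ν ^ 2) (a - r) x with hP
  set Q := fun x => 1 - τ + τ * gaussianTilt (ν ^ 2) (b - r) x with hQ
  have hP0 : ∀ x, 0 < P x := fun x => by have := gaussianTilt_pos (ν ^ 2) (a - r) x; positivity
  have hQ0 : ∀ x, 0 < Q x := fun x => by have := gaussianTilt_pos (ν ^ 2) (b - r) x; positivity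
  have hPm : Measurable P := ((measurable_gaussianTilt _ _).const_mul _).const_add _
  have hQm : Measurable Q := ((measurable_gaussianTilt _ _).const_mul _).const_add _
  have hfr : Measurable fun x => f (r + x) := hf.comp (measurable_const_add r)
  rw [lintegral_mixture hν hτ0.le hτ1.le r a hf,
    lintegral_mixture hν hτ0.le hτ1.le r b (hf.pow_const β)]
  have hconj : α.HolderConjugate β := Real.HolderConjugate.conjExponent hα
  have hH := ENNReal.lintegral_mul_le_Lp_mul_Lq (gaussianNoise d ν) hconj
    (f := fun x => ENNReal.ofReal (P x * Q x ^ (-(1 / β))))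
    (g := fun x => ENNReal.ofReal (Q x ^ (1 / β)) * f (r + x))
    (hPm.mul (hQm.pow_const _)).ennreal_ofReal.aemeasurable
    ((hQm.pow_const _).ennreal_ofReal.mul hfr).aemeasurable
  have e1 : ∀ x, ((fun x => ENNReal.ofReal (P x * Q x ^ (-(1 / β)))) *
      (fun x => ENNReal.ofReal (Q x ^ (1 / β)) * f (r + x))) x =
      ENNReal.ofReal (P x) * f (r + x) := by
    intro x
    have hp := (hP0 x).le
    have hq := hQ0 x
    rw [Pi.mul_apply, ← mul_assoc, ← ENNReal.ofReal_mul (by positivity), mul_assoc,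
      ← Real.rpow_add hq, neg_add_cancel, Real.rpow_zero, mul_one]
  have e2 : ∀ x, ENNReal.ofReal (P x * Q x ^ (-(1 / β))) ^ α =
      ENNReal.ofReal (P x ^ α * Q x ^ (1 - α)) := by
    intro x
    have hp := (hP0 x).le
    have hq := hQ0 x
    rw [ENNReal.ofReal_rpow_of_nonneg (by positivity) hα0.le, Real.mul_rpow hp (by positivity),
      ← Real.rpow_mul hq.le]
    congr 3
    rw [hβ]
    field_simp
    ring
  have e3 : ∀ x, (ENNReal.ofReal (Q x ^ (1 / β)) * f (r + x)) ^ β =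
      ENNReal.ofReal (Q x) * f (r + x) ^ β := by
    intro x
    have hq := hQ0 x
    rw [ENNReal.mul_rpow_of_nonneg _ _ hβ0.le, ENNReal.ofReal_rpow_of_nonneg (by positivity) hβ0.le,
      ← Real.rpow_mul hq.le, one_div_mul_cancel hβ0.ne', Real.rpow_one]
  simp only [e1, e2, e3] at hH
  refine hH.trans ?_
  gcongr
  calc _ ≤ ENNReal.ofReal (1 + (A * (τ ^ 2 * (3.2 * s)) +
          B * (τ ^ n * Real.exp (n * (n - 1) / 2 * s)))) ^ (1 / α) := by gcongr
    _ ≤ ENNReal.ofReal (Real.exp ((α - 1) * (7 / 2 * τ ^ 2 * α * s))) ^ (1 / α) := by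
        gcongr
        rw [add_comm]
        exact (Real.add_one_le_exp _).trans (Real.exp_le_exp.2 hcost)
    _ = _ := by
        rw [ENNReal.ofReal_rpow_of_nonneg (Real.exp_pos _).le (by positivity), ← Real.exp_mul]
        congr 2
        ring

end Mixture

/-! ### Uniform subsampling -/

lemma lintegral_uniformOn_finset {Ω : Type*} [MeasurableSpace Ω] [MeasurableSingletonClass Ω]
    (s : Finset Ω) (g : Ω → ℝ≥0∞) :
    ∫⁻ x, g x ∂(uniformOn (s : Set Ω)) = (∑ x ∈ s, g x) / s.card := by
  rw [uniformOn, ProbabilityTheory.cond, lintegral_smul_measure, lintegral_finset,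
    Measure.count_apply_finset]
  simp [ENNReal.div_eq_inv_mul]

/-- The pairs of an active set `A ∋ j` of `S` clients and of a client `k ∉ A` that may replace
`j`. -/
def exchangePairs (N S : ℕ) (j : Fin N) : Finset (Finset (Fin N) × Fin N) :=
  {i | i.1.card = S ∧ j ∈ i.1 ∧ i.2 ∉ i.1}

/-- Replace `j` by `k` in the active set. -/
def exchange {N : ℕ} (j : Fin N) (i : Finset (Fin N) × Fin N) : Finset (Fin N) :=
  insert i.2 (i.1.erase j)

lemma sum_exchangePairs_fst {N S : ℕ} (j : Fin N) (g : Finset (Fin N) → ℝ≥0∞) :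
    ∑ i ∈ exchangePairs N S j, g i.1 =
      ((N - S : ℕ) : ℝ≥0∞) * ∑ A with A.card = S ∧ j ∈ A, g A := by
  rw [exchangePairs, Finset.sum_filter, Fintype.sum_prod_type, Finset.mul_sum, Finset.sum_filter]
  refine Finset.sum_congr rfl fun A _ => ?_
  by_cases h : A.card = S ∧ j ∈ A
  · rw [if_pos h, ← h.1, ← Finset.sum_filter]
    have e : ({k | A.card = A.card ∧ j ∈ A ∧ k ∉ A} : Finset (Fin N)) = Aᶜ := by
      ext k; simp [h.2]
    rw [e]
    simp [Finset.card_compl]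
  · rw [if_neg h]
    exact Finset.sum_eq_zero fun k _ => if_neg fun hk => h ⟨hk.1, hk.2.1⟩

lemma sum_exchangePairs_exchange {N S : ℕ} (j : Fin N) (g : Finset (Fin N) → ℝ≥0∞) :
    ∑ i ∈ exchangePairs N S j, g (exchange j i) =
      (S : ℝ≥0∞) * ∑ A with A.card = S ∧ j ∉ A, g A := by
  have h1 : ∑ i ∈ exchangePairs N S j, g (exchange j i) =
      ∑ i : Finset (Fin N) × Fin N with i.1.card = S ∧ j ∉ i.1 ∧ i.2 ∈ i.1, g i.1 := by
    refine Finset.sum_bij' (fun i _ => (exchange j i, i.2))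
      (fun i _ => (insert j (i.1.erase i.2), i.2)) ?_ ?_ ?_ ?_ ?_
    · rintro ⟨A, k⟩ h
      simp only [exchangePairs, Finset.mem_filter, Finset.mem_univ, true_and] at h
      obtain ⟨h1, h2, h3⟩ := h
      have hjk : j ≠ k := by rintro rfl; exact h3 h2
      have h4 : k ∉ A.erase j := fun h => h3 (Finset.mem_of_mem_erase h)
      have h5 : 0 < A.card := Finset.card_pos.2 ⟨j, h2⟩
      simp only [exchange, Finset.mem_filter, Finset.mem_univ, true_and, Finset.mem_insert_self,
        and_true, Finset.card_insert_of_notMem h4, Finset.card_erase_of_mem h2]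
      refine ⟨by omega, ?_⟩
      simp [hjk]
    · rintro ⟨A, k⟩ h
      simp only [Finset.mem_filter, Finset.mem_univ, true_and] at h
      obtain ⟨h1, h2, h3⟩ := h
      have hjk : k ≠ j := by rintro rfl; exact h2 h3
      have h4 : j ∉ A.erase k := fun h => h2 (Finset.mem_of_mem_erase h)
      have h5 : 0 < A.card := Finset.card_pos.2 ⟨k, h3⟩
      simp only [exchangePairs, Finset.mem_filter, Finset.mem_univ, true_and,
        Finset.mem_insert_self, Finset.card_insert_of_notMem h4, Finset.card_erase_of_mem h3]
      refine ⟨by omega, ?_⟩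
      simp [hjk]
    · rintro ⟨A, k⟩ h
      simp only [exchangePairs, Finset.mem_filter, Finset.mem_univ, true_and] at h
      obtain ⟨h1, h2, h3⟩ := h
      have h4 : k ∉ A.erase j := fun h => h3 (Finset.mem_of_mem_erase h)
      simp [exchange, Finset.erase_insert h4, Finset.insert_erase h2]
    · rintro ⟨A, k⟩ h
      simp only [Finset.mem_filter, Finset.mem_univ, true_and] at h
      obtain ⟨h1, h2, h3⟩ := h
      have h4 : j ∉ A.erase k := fun h => h2 (Finset.mem_of_mem_erase h)
      simp [exchange, Finset.erase_insert h4, Finset.insert_erase h3]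
    · intros; rfl
  rw [h1, Finset.sum_filter, Fintype.sum_prod_type, Finset.mul_sum, Finset.sum_filter]
  refine Finset.sum_congr rfl fun A _ => ?_
  by_cases h : A.card = S ∧ j ∉ A
  · rw [if_pos h, ← h.1, ← Finset.sum_filter]
    have e : ({k | A.card = A.card ∧ j ∉ A ∧ k ∈ A} : Finset (Fin N)) = A := by
      ext k; simp [h.2]
    rw [e]
    simp
  · rw [if_neg h]
    exact Finset.sum_eq_zero fun k _ => if_neg fun hk => h ⟨hk.1, hk.2.1⟩

lemma sum_exchangePairs {N S : ℕ} (j : Fin N) (g : Finset (Fin N) → ℝ≥0∞) :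
    ∑ i ∈ exchangePairs N S j, (((N - S : ℕ) : ℝ≥0∞) * g (exchange j i) + S * g i.1) =
      (((N - S : ℕ) : ℝ≥0∞) * S) * ∑ A with A.card = S, g A := by
  rw [Finset.sum_add_distrib, ← Finset.mul_sum, ← Finset.mul_sum, sum_exchangePairs_fst,
    sum_exchangePairs_exchange,
    ← Finset.sum_filter_add_sum_filter_not {A : Finset (Fin N) | A.card = S} (fun A => j ∈ A) g,
    Finset.filter_filter, Finset.filter_filter]
  ring

/-- A uniform active set, seen from client `j`: a uniform pair `i` in `exchangePairs N S j` is
drawn, and then `j` is active, with probability `τ`, in the set `i.1`, or is replaced, with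
probability `1 - τ`, by the client `i.2`. -/
lemma lintegral_uniformOn_card_eq {N S : ℕ} (hS0 : 0 < S) (hSN : S < N) {τ : ℝ}
    (hτ : (S : ℝ) = τ * N) (j : Fin N) (g : Finset (Fin N) → ℝ≥0∞) :
    ∫⁻ A, g A ∂(uniformOn {A : Finset (Fin N) | A.card = S}) =
      ∫⁻ i, (ENNReal.ofReal (1 - τ) * g (exchange j i) + ENNReal.ofReal τ * g i.1)
        ∂(uniformOn (exchangePairs N S j : Set (Finset (Fin N) × Fin N))) := by
  have hN : (0 : ℝ) < N := by exact_mod_cast hS0.trans hSN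
  have hset : {A : Finset (Fin N) | A.card = S} =
      (({A | A.card = S} : Finset (Finset (Fin N))) : Set (Finset (Fin N))) := by
    ext A; simp
  rw [hset, lintegral_uniformOn_finset, lintegral_uniformOn_finset]
  set c : ℝ≥0∞ := ((N - S : ℕ) : ℝ≥0∞) * S with hc
  have hc0 : c ≠ 0 := by
    rw [hc]
    refine mul_ne_zero ?_ ?_
    · exact_mod_cast (Nat.sub_pos_of_lt hSN).ne'
    · exact_mod_cast hS0.ne'
  have hct : c ≠ ∞ := ENNReal.mul_ne_top (ENNReal.natCast_ne_top _) (ENNReal.natCast_ne_top _)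
  have hSe : (S : ℝ≥0∞) = N * ENNReal.ofReal τ := by
    rw [← ENNReal.ofReal_natCast, ← ENNReal.ofReal_natCast, ← ENNReal.ofReal_mul hN.le, hτ,
      mul_comm]
  have hNSe : ((N - S : ℕ) : ℝ≥0∞) = N * ENNReal.ofReal (1 - τ) := by
    rw [← ENNReal.ofReal_natCast, ← ENNReal.ofReal_natCast, ← ENNReal.ofReal_mul hN.le,
      Nat.cast_sub hSN.le, hτ]
    ring_nf
  have h1 : c * ∑ A with A.card = S, g A = N * ∑ i ∈ exchangePairs N S j,
      (ENNReal.ofReal (1 - τ) * g (exchange j i) + ENNReal.ofReal τ * g i.1) := by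
    rw [hc, ← sum_exchangePairs j, Finset.mul_sum]
    refine Finset.sum_congr rfl fun i _ => ?_
    rw [hSe, hNSe]
    ring
  have h2 : c * (({A | A.card = S} : Finset (Finset (Fin N))).card : ℝ≥0∞) =
      N * ((exchangePairs N S j).card : ℝ≥0∞) := by
    have h := sum_exchangePairs (S := S) j (fun _ => 1)
    have e : ((N - S : ℕ) : ℝ≥0∞) + S = N := by
      rw [← Nat.cast_add, Nat.sub_add_cancel hSN.le]
    simp only [mul_one, Finset.sum_const, nsmul_eq_mul, e] at h
    rw [hc, ← h, mul_comm]
  rw [← ENNReal.mul_div_mul_left _ _ hc0 hct, h1, h2,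
    ENNReal.mul_div_mul_left _ _ (by exact_mod_cast hN.ne') (ENNReal.natCast_ne_top N)]

lemma nonempty_exchangePairs {N S : ℕ} (hS0 : 0 < S) (hSN : S < N) (j : Fin N) :
    (exchangePairs N S j).Nonempty := by
  obtain ⟨A, hjA, -, hA⟩ := Finset.exists_subsuperset_card_eq
    (Finset.subset_univ ({j} : Finset (Fin N))) (n := S) (by rw [Finset.card_singleton]; exact hS0)
    (by simpa using hSN.le)
  obtain ⟨k, hk⟩ : ∃ k, k ∉ A := by
    by_contra! h
    have : A = Finset.univ := Finset.eq_univ_iff_forall.2 h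
    rw [this, Finset.card_univ, Fintype.card_fin] at hA
    omega
  exact ⟨(A, k), by simp [exchangePairs, hA, hk, Finset.singleton_subset_iff.1 hjA]⟩

/-! ### The subsampled Gaussian mechanism -/

lemma map_update_pi {ι X : Type*} [Fintype ι] [DecidableEq ι] [MeasurableSpace X]
    {m m' : ι → Measure X} [∀ i, IsProbabilityMeasure (m i)] [∀ i, IsProbabilityMeasure (m' i)]
    {j : ι} (h : ∀ i, i ≠ j → m i = m' i) :
    ((Measure.pi m).prod (m' j)).map (fun x => Function.update x.1 j x.2) = Measure.pi m' := by
  have hmeas : Measurable fun x : (ι → X) × X => Function.update x.1 j x.2 := measurable_update'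
  refine (Measure.pi_eq fun s hs => ?_).symm
  rw [Measure.map_apply hmeas (MeasurableSet.univ_pi hs)]
  have e : (fun x : (ι → X) × X => Function.update x.1 j x.2) ⁻¹' (Set.univ.pi s) =
      (Set.univ.pi (Function.update s j Set.univ)) ×ˢ s j := by
    ext ⟨v, z⟩
    simp only [Set.mem_preimage, Set.mem_pi, Set.mem_univ, true_implies, Set.mem_prod]
    constructor
    · intro H
      refine ⟨fun i => ?_, by simpa using H j⟩
      by_cases hi : i = j
      · subst hi
        simp
      · simpa [hi] using H i
    · rintro ⟨H, Hz⟩ i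
      by_cases hi : i = j
      · subst hi
        simpa using Hz
      · simpa [hi] using H i
  rw [e, Measure.prod_prod, Measure.pi_pi, ← Finset.prod_erase_mul _ _ (Finset.mem_univ j),
    ← Finset.prod_erase_mul _ _ (Finset.mem_univ j)]
  simp only [Function.update_self, measure_univ, mul_one]
  congr 1
  refine Finset.prod_congr rfl fun i hi => ?_
  have hij := Finset.ne_of_mem_erase hi
  rw [Function.update_of_ne hij, h i hij]

section NoisySum

variable {d N : ℕ}

/-- The law of `∑ j ∈ A, v j + n` for a uniform set `A` of `S` clients, independent updates `v j`
with laws `m j`, and Gaussian noise `n`. -/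
noncomputable def noisySum (S : ℕ) (ν : ℝ) (m : Fin N → Measure (EuclideanSpace ℝ (Fin d))) :
    Measure (EuclideanSpace ℝ (Fin d)) :=
  ((uniformOn {A : Finset (Fin N) | A.card = S}).prod
    ((Measure.pi m).prod (gaussianNoise d ν))).map fun x => ∑ j ∈ x.1, x.2.1 j + x.2.2

lemma measurable_sum_mem {E : Type*} [MeasurableSpace E] [AddCommMonoid E] [MeasurableAdd₂ E] :
    Measurable fun x : Finset (Fin N) × (Fin N → E) => ∑ j ∈ x.1, x.2 j :=
  measurable_from_prod_countable_right fun A =>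
    Finset.measurable_sum A fun j _ => measurable_pi_apply j

lemma measurable_noisySum :
    Measurable fun x : Finset (Fin N) × (Fin N → EuclideanSpace ℝ (Fin d)) ×
      EuclideanSpace ℝ (Fin d) => ∑ j ∈ x.1, x.2.1 j + x.2.2 :=
  (measurable_sum_mem.comp (measurable_fst.prodMk (measurable_fst.comp measurable_snd))).add
    (measurable_snd.comp measurable_snd)

lemma lintegral_noisySum (S : ℕ) (ν : ℝ) (m : Fin N → Measure (EuclideanSpace ℝ (Fin d)))
    [∀ j, IsProbabilityMeasure (m j)] {f : EuclideanSpace ℝ (Fin d) → ℝ≥0∞} (hf : Measurable f) :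
    ∫⁻ y, f y ∂(noisySum S ν m) =
      ∫⁻ A, ∫⁻ v, ∫⁻ x, f (∑ j ∈ A, v j + x) ∂(gaussianNoise d ν) ∂(Measure.pi m)
        ∂(uniformOn {A : Finset (Fin N) | A.card = S}) := by
  have hm : Measurable fun x : Finset (Fin N) × (Fin N → EuclideanSpace ℝ (Fin d)) ×
      EuclideanSpace ℝ (Fin d) => f (∑ j ∈ x.1, x.2.1 j + x.2.2) := hf.comp measurable_noisySum
  rw [noisySum, lintegral_map hf measurable_noisySum]
  refine (lintegral_prod _ hm.aemeasurable).trans (lintegral_congr fun A => ?_)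
  exact lintegral_prod _ (hm.comp measurable_prodMk_left).aemeasurable

/-- Privacy amplification by subsampling: replacing the law of the update of one client changes
`noisySum` by a Rényi divergence of at most `7 / 2 * τ ^ 2 * α * s`.  The two laws are coupled so
that, given the coupling variables, both are mixtures of two Gaussians, with weights `1 - τ` and
`τ`, the first of which they share. -/
lemma holderDominated_noisySum {S : ℕ} (hS0 : 0 < S) (hSN : S < N) {α τ s ν L : ℝ}
    (hτ : (S : ℝ) = τ * N) (hν : ν ≠ 0) (hα : 1 < α) (hτ0 : 0 < τ) (hτ1 : τ < 1)
    (hs0 : 0 < s) (hs : s ≤ 3 / 2) (hsL : 4 * L ^ 2 ≤ s * ν ^ 2)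
    (h : τ * α * (1 + 1 / s) * Real.exp (3 / 2 * s * (α - 1)) ≤ 1)
    {m m' : Fin N → Measure (EuclideanSpace ℝ (Fin d))} [∀ j, IsProbabilityMeasure (m j)]
    [∀ j, IsProbabilityMeasure (m' j)] (hm : ∀ j, ∀ᵐ y ∂(m j), ‖y‖ ≤ L)
    (hm' : ∀ j, ∀ᵐ y ∂(m' j), ‖y‖ ≤ L) {j : Fin N} (hj : ∀ i, i ≠ j → m i = m' i) :
    HolderDominated (α / (α - 1))
      (ENNReal.ofReal (Real.exp (7 / 2 * τ ^ 2 * α * s * ((α - 1) / α))))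
      (noisySum S ν m) (noisySum S ν m') := by
  intro f hf
  set β := α / (α - 1) with hβ
  have hβ1 : 1 < β := by rw [hβ, one_lt_div (by linarith)]; linarith
  set u := uniformOn (exchangePairs N S j : Set (Finset (Fin N) × Fin N)) with hu
  have : IsProbabilityMeasure u := isProbabilityMeasure_uniformOn (Set.toFinite _)
    (nonempty_exchangePairs hS0 hSN j)
  set F : (EuclideanSpace ℝ (Fin d) → ℝ≥0∞) → EuclideanSpace ℝ (Fin d) → ℝ≥0∞ :=
    fun g y => ∫⁻ x, g (y + x) ∂(gaussianNoise d ν) with hF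
  have hFm : ∀ {g : EuclideanSpace ℝ (Fin d) → ℝ≥0∞}, Measurable g → Measurable (F g) :=
    fun hg => measurable_lintegral_add_gaussianNoise hg
  have hFA : ∀ {g : EuclideanSpace ℝ (Fin d) → ℝ≥0∞}, Measurable g → ∀ A : Finset (Fin N),
      Measurable fun v : Fin N → EuclideanSpace ℝ (Fin d) => F g (∑ i ∈ A, v i) :=
    fun hg A => (hFm hg).comp (measurable_sum_mem.comp measurable_prodMk_left)
  have hupd : Measurable fun x : (Fin N → EuclideanSpace ℝ (Fin d)) × EuclideanSpace ℝ (Fin d) =>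
      Function.update x.1 j x.2 := measurable_update'
  -- the coupled laws, as mixtures of two Gaussians given `i`, the updates `v` and the update `z`
  -- of the new client `j`
  set G : Finset (Fin N) × Fin N → (Fin N → EuclideanSpace ℝ (Fin d)) → ℝ≥0∞ := fun i v =>
    ENNReal.ofReal (1 - τ) * F f (∑ k ∈ exchange j i, v k) +
      ENNReal.ofReal τ * F f (∑ k ∈ i.1, v k) with hG
  set G' : Finset (Fin N) × Fin N → (Fin N → EuclideanSpace ℝ (Fin d)) → ℝ≥0∞ := fun i v =>
    ENNReal.ofReal (1 - τ) * F (fun x => f x ^ β) (∑ k ∈ exchange j i, v k) +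
      ENNReal.ofReal τ * F (fun x => f x ^ β) (∑ k ∈ i.1, v k) with hG'
  have hGm : ∀ i, Measurable (G i) := fun i =>
    ((hFA hf _).const_mul _).add ((hFA hf _).const_mul _)
  have hGm' : ∀ i, Measurable (G' i) := fun i =>
    ((hFA (hf.pow_const β) _).const_mul _).add ((hFA (hf.pow_const β) _).const_mul _)
  have e1 : ∫⁻ y, f y ∂(noisySum S ν m) =
      ∫⁻ x, G x.1 x.2.1 ∂(u.prod ((Measure.pi m).prod (m' j))) := by
    rw [lintegral_noisySum S ν m hf, lintegral_uniformOn_card_eq hS0 hSN hτ j, lintegral_prod]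
    · refine lintegral_congr fun i => ?_
      rw [lintegral_prod (fun x => G i x.1) ((hGm i).comp measurable_fst).aemeasurable]
      simp only [lintegral_const, measure_univ, mul_one]
      rw [hG, lintegral_add_left ((hFA hf _).const_mul _), lintegral_const_mul _ (hFA hf _),
        lintegral_const_mul _ (hFA hf _)]
    · exact (measurable_from_prod_countable_right fun i =>
        (hGm i).comp measurable_fst).aemeasurable
  have e2 : ∫⁻ y, f y ^ β ∂(noisySum S ν m') =
      ∫⁻ x, G' x.1 (Function.update x.2.1 j x.2.2) ∂(u.prod ((Measure.pi m).prod (m' j))) := by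
    rw [lintegral_noisySum S ν m' (hf.pow_const β), lintegral_uniformOn_card_eq hS0 hSN hτ j,
      lintegral_prod]
    · refine lintegral_congr fun i => ?_
      rw [← lintegral_map (hGm' i) hupd, map_update_pi hj, hG',
        lintegral_add_left ((hFA (hf.pow_const β) _).const_mul _),
        lintegral_const_mul _ (hFA (hf.pow_const β) _),
        lintegral_const_mul _ (hFA (hf.pow_const β) _)]
    · exact (measurable_from_prod_countable_right fun i => (hGm' i).comp hupd).aemeasurable
  have hGm2 : Measurable fun x : (Finset (Fin N) × Fin N) ×
      (Fin N → EuclideanSpace ℝ (Fin d)) × EuclideanSpace ℝ (Fin d) =>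
        G' x.1 (Function.update x.2.1 j x.2.2) :=
    measurable_from_prod_countable_right fun i => (hGm' i).comp hupd
  have hae : ∀ᵐ x ∂(u.prod ((Measure.pi m).prod (m' j))),
      x.1 ∈ exchangePairs N S j ∧ (∀ k, ‖x.2.1 k‖ ≤ L) ∧ ‖x.2.2‖ ≤ L := by
    have a1 : ∀ᵐ i ∂u, i ∈ exchangePairs N S j := by
      rw [hu, uniformOn]
      exact ae_cond_mem (Finset.measurableSet (exchangePairs N S j))
    have a2 : ∀ᵐ v ∂(Measure.pi m), ∀ k, ‖v k‖ ≤ L := ae_all_iff.2 fun k =>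
      (Measure.quasiMeasurePreserving_eval m k).ae (hm k)
    filter_upwards [Measure.quasiMeasurePreserving_fst.ae a1,
      Measure.quasiMeasurePreserving_snd.ae (Measure.quasiMeasurePreserving_fst.ae a2),
      Measure.quasiMeasurePreserving_snd.ae (Measure.quasiMeasurePreserving_snd.ae (hm' j))]
      with x h1 h2 h3 using ⟨h1, h2, h3⟩
  have hnorm : ∀ y z : EuclideanSpace ℝ (Fin d), ‖y‖ ≤ L → ‖z‖ ≤ L →
      ‖y - z‖ ^ 2 ≤ s * ν ^ 2 := by
    intro y z hy hz
    refine le_trans ?_ hsL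
    have h1 : ‖y - z‖ ≤ 2 * L := (norm_sub_le y z).trans (by linarith)
    calc ‖y - z‖ ^ 2 ≤ (2 * L) ^ 2 := by gcongr
      _ = 4 * L ^ 2 := by ring
  have key : ∀ᵐ x ∂(u.prod ((Measure.pi m).prod (m' j))), G x.1 x.2.1 ≤
      ENNReal.ofReal (Real.exp (7 / 2 * τ ^ 2 * α * s * ((α - 1) / α))) *
        G' x.1 (Function.update x.2.1 j x.2.2) ^ (1 / β) := by
    filter_upwards [hae] with ⟨⟨A, k⟩, v, z⟩ hx
    obtain ⟨hA, hv, hz⟩ := hx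
    simp only [exchangePairs, Finset.mem_filter, Finset.mem_univ, true_and] at hA hv hz
    obtain ⟨-, hjA, hkA⟩ := hA
    have hk : k ∉ A.erase j := fun h => hkA (Finset.mem_of_mem_erase h)
    have hkj : k ≠ j := by rintro rfl; exact hkA hjA
    set c := ∑ i ∈ A.erase j, v i with hc
    have s1 : ∑ i ∈ exchange j (A, k), v i = v k + c := by
      rw [exchange, Finset.sum_insert hk]
    have s2 : ∑ i ∈ A, v i = v j + c := (Finset.add_sum_erase A v hjA).symm
    have s3 : ∑ i ∈ A.erase j, Function.update v j z i = c :=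
      Finset.sum_congr rfl fun i hi => Function.update_of_ne (Finset.ne_of_mem_erase hi) _ _
    have s4 : ∑ i ∈ exchange j (A, k), Function.update v j z i = v k + c := by
      rw [exchange, Finset.sum_insert hk, s3, Function.update_of_ne hkj]
    have s5 : ∑ i ∈ A, Function.update v j z i = z + c := by
      rw [← Finset.add_sum_erase A _ hjA, s3, Function.update_self]
    simp only [hG, hG', s1, s2, s4, s5]
    refine mixture_le_rpow hν hα hτ0 hτ1 hs0 hs h ?_ ?_ ?_ hf
    · rw [add_sub_add_right_eq_sub]; exact hnorm _ _ (hv j) (hv k)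
    · rw [add_sub_add_right_eq_sub]; exact hnorm _ _ hz (hv k)
    · rw [add_sub_add_right_eq_sub]; exact hnorm _ _ (hv j) hz
  rw [e1, e2]
  calc _ ≤ _ := lintegral_mono_ae key
    _ = _ * ∫⁻ x, G' x.1 (Function.update x.2.1 j x.2.2) ^ (1 / β)
          ∂(u.prod ((Measure.pi m).prod (m' j))) :=
        lintegral_const_mul _ (hGm2.pow_const _)
    _ ≤ _ := by
        gcongr
        exact lintegral_rpow_one_div_le hβ1 hGm2

end NoisySum

/-! ### One round of the algorithm -/

lemma norm_clip_le {d : ℕ} {L : ℝ} (hL : 0 < L) (v : EuclideanSpace ℝ (Fin d)) :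
    ‖clip L v‖ ≤ L := by
  have h1 : 0 < max 1 (‖v‖ / L) := lt_max_of_lt_left one_pos
  rw [clip, norm_smul, norm_inv, Real.norm_of_nonneg h1.le, inv_mul_le_iff₀ h1]
  calc ‖v‖ = ‖v‖ / L * L := by field_simp
    _ ≤ max 1 (‖v‖ / L) * L := by gcongr; exact le_max_right _ _

section Round

variable {d K N : ℕ} {Z : Type*}

lemma Client.norm_update_le (c : Client d Z K) (η : ℝ) {L : ℝ} (hL : 0 < L)
    (B : Fin K → Multiset (Fin c.size)) (w : EuclideanSpace ℝ (Fin d)) :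
    ‖c.update η L B w‖ ≤ L := by
  cases K with
  | zero =>
    have : c.update η L B w = 0 := sub_self w
    rw [this, norm_zero]
    exact hL.le
  | succ K =>
    rw [Client.update, Client.localModel, ← Fin.succ_last, Fin.induction_succ, add_sub_cancel_left]
    exact norm_clip_le hL _

/-- The law of the update returned by a client in one round. -/
noncomputable def Client.updateLaw (c : Client d Z K) (η L : ℝ) (w : EuclideanSpace ℝ (Fin d)) :
    Measure (EuclideanSpace ℝ (Fin d)) :=
  c.batchLaw.toMeasure.map fun B => c.update η L B w

instance isProbabilityMeasure_updateLaw (c : Client d Z K) (η L : ℝ)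
    (w : EuclideanSpace ℝ (Fin d)) : IsProbabilityMeasure (c.updateLaw η L w) :=
  Measure.isProbabilityMeasure_map (Measurable.of_discrete).aemeasurable

lemma Client.ae_norm_updateLaw_le (c : Client d Z K) (η : ℝ) {L : ℝ} (hL : 0 < L)
    (w : EuclideanSpace ℝ (Fin d)) : ∀ᵐ y ∂(c.updateLaw η L w), ‖y‖ ≤ L := by
  rw [Client.updateLaw, ae_map_iff (Measurable.of_discrete).aemeasurable
    (measurableSet_le measurable_norm measurable_const)]
  exact ae_of_all _ fun B => c.norm_update_le η hL B w

/-- The server's step is a post-processing of the noisy sum of the updates. -/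
lemma map_serverStep_roundLaw (p : Params d) (D : Fin N → Client d Z K)
    (w : EuclideanSpace ℝ (Fin d)) :
    (roundLaw p D).map (serverStep p D w) =
      (noisySum p.active p.noise
        fun j => (D j).updateLaw p.localRate p.clipping w).map fun y =>
          w + (p.globalRate / p.active) •
            Matrix.toEuclideanCLM (𝕜 := ℝ) (smoothingMatrix d p.smoothing)⁻¹ y := by
  have hpost : Measurable fun y : EuclideanSpace ℝ (Fin d) => w + (p.globalRate / p.active : ℝ) •
      Matrix.toEuclideanCLM (𝕜 := ℝ) (smoothingMatrix d p.smoothing)⁻¹ y := by fun_prop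
  have hu : Measurable fun (B : (j : Fin N) → Fin K → Multiset (Fin (D j).size)) (j : Fin N) =>
      (D j).update p.localRate p.clipping (B j) w :=
    measurable_pi_lambda _ fun j => (Measurable.of_discrete (f := fun B =>
      (D j).update p.localRate p.clipping B w)).comp (measurable_pi_apply j)
  have e : (uniformOn {A : Finset (Fin N) | A.card = p.active}).prod
      ((Measure.pi fun j => (D j).updateLaw p.localRate p.clipping w).prod
        (gaussianNoise d p.noise)) =
      (roundLaw p D).map (Prod.map id (Prod.map
        (fun B j => (D j).update p.localRate p.clipping (B j) w) id)) := by
    rw [roundLaw, ← Measure.map_prod_map _ _ measurable_id (hu.prodMap measurable_id),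
      ← Measure.map_prod_map _ _ hu measurable_id, Measure.map_id, Measure.map_id]
    congr 2
    exact (Measure.pi_map_pi (μ := fun j => (D j).batchLaw.toMeasure)
      (f := fun j B => (D j).update p.localRate p.clipping B w)
      fun j => (Measurable.of_discrete).aemeasurable).symm
  rw [noisySum, e, Measure.map_map measurable_noisySum
    (measurable_id.prodMap (hu.prodMap measurable_id)), Measure.map_map hpost
    (measurable_noisySum.comp (measurable_id.prodMap (hu.prodMap measurable_id)))]
  rfl

/-- The output is a post-processing of the trajectory of the global models. -/
lemma dpFedLS_eq_map_trajectory (p : Params d) (D : Fin N → Client d Z K) :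
    dpFedLS p D = ((Measure.pi fun _ : Fin p.rounds => roundLaw p D).map
      (trajectory (serverStep p D) p.init)).map fun x => ∑ t, p.weight t • x t := by
  have h : Measurable (trajectory (serverStep p D) p.init (n := p.rounds)) :=
    (measurable_trajectory (measurable_serverStep p D) _).comp measurable_prodMk_left
  rw [Measure.map_map (by fun_prop) h]
  rfl

/-- Differential privacy of DP-Fed-LS: composition of the rounds, post-processing, and conversion
of the Rényi divergence bound of order `α`. -/
lemma isDP_dpFedLS (p : Params d) {τ ε δ lam α : ℝ}
    (hτ0 : 0 < τ) (hS : (p.active : ℝ) = τ * N) (hN : 0 < N)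
    (hL : 0 < p.clipping) (hε : 0 < ε) (hδ0 : 0 < δ) (hδ1 : δ < 1) (hlam0 : 0 < lam)
    (hlam1 : lam < 1) (hα : α = Real.log (1 / δ) / ((1 - lam) * ε) + 1)
    (hν : τ * p.clipping / ε *
        Real.sqrt (14 * p.rounds / lam * (Real.log (1 / δ) / (1 - lam) + ε)) ≤ p.noise)
    (hν1 : 2 / 3 ≤ p.noise ^ 2 / (4 * p.clipping ^ 2))
    (hν2 : α - 1 ≤ p.noise ^ 2 / (6 * p.clipping ^ 2) *
        Real.log (1 / (τ * α * (1 + p.noise ^ 2 / (4 * p.clipping ^ 2))))) :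
    IsDP ReplaceOne (dpFedLS p : (Fin N → Client d Z K) → _) ε δ := by
  set ν := p.noise with hνdef
  set L := p.clipping with hLdef
  have hlog : 0 < Real.log (1 / δ) := Real.log_pos ((one_lt_div hδ0).2 hδ1)
  have hlam' : 0 < 1 - lam := by linarith
  have hα1 : 1 < α := by
    rw [hα]
    have : 0 < Real.log (1 / δ) / ((1 - lam) * ε) := by positivity
    linarith
  have hα0 : 0 < α := by linarith
  have hν0 : ν ≠ 0 := by
    intro h
    rw [h] at hν1
    norm_num at hν1
  have hν2pos : 0 < ν ^ 2 := by positivity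
  -- `s` is the squared ratio of the sensitivity `2 L` and the noise level
  set s := 4 * L ^ 2 / ν ^ 2 with hs
  have hs0 : 0 < s := by positivity
  have hs1 : s ≤ 3 / 2 := by
    rw [hs, div_le_iff₀ hν2pos]
    rw [le_div_iff₀ (by positivity)] at hν1
    linarith
  have hsinv : ν ^ 2 / (4 * L ^ 2) = 1 / s := by rw [hs, one_div_div]
  have hcond : τ * α * (1 + 1 / s) * Real.exp (3 / 2 * s * (α - 1)) ≤ 1 := by
    have hpos : 0 < τ * α * (1 + 1 / s) := by positivity
    have e : ν ^ 2 / (6 * L ^ 2) = 1 / (3 / 2 * s) := by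
      rw [hs]
      field_simp
      norm_num
    rw [hsinv, e, one_div_mul_eq_div, le_div_iff₀ (by positivity)] at hν2
    rw [← le_div_iff₀' hpos]
    refine (Real.le_log_iff_exp_le (by positivity)).1 ?_
    linarith
  have hτ1 : τ < 1 := by
    have h1 : τ * 1 < τ * α := mul_lt_mul_of_pos_left hα1 hτ0
    have h2 : τ * α * 1 < τ * α * (1 + 1 / s) := by
      have : 0 < 1 / s := by positivity
      gcongr
      linarith
    have h3 : 1 ≤ Real.exp (3 / 2 * s * (α - 1)) :=
      Real.one_le_exp (mul_nonneg (by positivity) (by linarith))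
    have h4 : τ * α * (1 + 1 / s) * 1 ≤ 1 := le_trans (by gcongr) hcond
    linarith
  have hNr : (0 : ℝ) < N := by exact_mod_cast hN
  have hS0 : 0 < p.active := by
    have : (0 : ℝ) < p.active := by rw [hS]; positivity
    exact_mod_cast this
  have hSN : p.active < N := by
    have : (p.active : ℝ) < N := by rw [hS]; exact mul_lt_of_lt_one_left hNr hτ1
    exact_mod_cast this
  -- the total privacy cost of all rounds
  have hcost : p.rounds * (7 / 2 * τ ^ 2 * α * s) ≤ lam * ε := by
    have hεα : Real.log (1 / δ) / (1 - lam) + ε = ε * α := by rw [hα]; field_simp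
    rw [hεα] at hν
    have h1 : (τ * L / ε * Real.sqrt (14 * p.rounds / lam * (ε * α))) ^ 2 ≤ ν ^ 2 := by gcongr
    rw [mul_pow, Real.sq_sqrt (by positivity)] at h1
    have e : p.rounds * (7 / 2 * τ ^ 2 * α * s) =
        (τ * L / ε) ^ 2 * (14 * p.rounds / lam * (ε * α)) * (lam * ε) / ν ^ 2 := by
      rw [hs]
      field_simp
      ring
    rw [e, div_le_iff₀ hν2pos, mul_comm (lam * ε)]
    gcongr
  rintro D D' ⟨j, hj⟩ O hO
  have := isProbabilityMeasure_roundLaw p D hSN.le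
  have := isProbabilityMeasure_roundLaw p D' hSN.le
  have := isProbabilityMeasure_dpFedLS p D hSN.le
  have := isProbabilityMeasure_dpFedLS p D' hSN.le
  have hround : ∀ w, HolderDominated (α / (α - 1))
      (ENNReal.ofReal (Real.exp (7 / 2 * τ ^ 2 * α * s * ((α - 1) / α))))
      ((roundLaw p D).map (serverStep p D w)) ((roundLaw p D').map (serverStep p D' w)) := by
    intro w
    rw [map_serverStep_roundLaw, map_serverStep_roundLaw]
    refine HolderDominated.map ?_ (by fun_prop)
    exact holderDominated_noisySum hS0 hSN hS hν0 hα1 hτ0 hτ1 hs0 hs1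
      (by rw [hs, div_mul_cancel₀ _ hν2pos.ne']) hcond
      (fun i => (D i).ae_norm_updateLaw_le _ hL w) (fun i => (D' i).ae_norm_updateLaw_le _ hL w)
      (j := j) fun i hi => by rw [hj i hi]
  have htraj := HolderDominated.trajectory (measurable_serverStep p D)
    (measurable_serverStep p D') (by have : 0 < α - 1 := by linarith
                                     positivity) hround p.rounds p.init
  have hout := htraj.map (g := fun x : Fin (p.rounds + 1) → EuclideanSpace ℝ (Fin d) =>
    ∑ t, p.weight t • x t) (by fun_prop)
  rw [← dpFedLS_eq_map_trajectory, ← dpFedLS_eq_map_trajectory,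
    ← ENNReal.ofReal_pow (Real.exp_pos _).le, ← Real.exp_nat_mul, ← mul_assoc] at hout
  refine HolderDominated.measureReal_le hα1 hδ0
    (ρ := p.rounds * (7 / 2 * τ ^ 2 * α * s)) ?_ hout hO
  have e : Real.log (1 / δ) / (α - 1) = (1 - lam) * ε := by
    rw [hα, add_sub_cancel_right]
    field_simp
  rw [e]
  linarith

end Round

end DPFed

theorem mainTheorem1 {d N K : ℕ} {Z : Type*} (p : DPFed.Params d) (τ ε δ lam α : ℝ)
    (hN : 0 < N) (hτ0 : 0 < τ) (hτ1 : τ ≤ 1) (hS : (p.active : ℝ) = τ * N)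
    (hL : 0 < p.clipping) (hσ : 0 ≤ p.smoothing)
    (ha : ∀ t, p.weight t ∈ Set.Icc (0 : ℝ) 1) (ha1 : ∑ t, p.weight t = 1)
    (hε : 0 < ε) (hδ0 : 0 < δ) (hδ1 : δ < 1) (hlam0 : 0 < lam) (hlam1 : lam < 1)
    (hα : α = Real.log (1 / δ) / ((1 - lam) * ε) + 1)
    (hν : τ * p.clipping / ε *
        Real.sqrt (14 * p.rounds / lam * (Real.log (1 / δ) / (1 - lam) + ε)) ≤ p.noise)
    (hν1 : 2 / 3 ≤ p.noise ^ 2 / (4 * p.clipping ^ 2))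
    (hν2 : α - 1 ≤ p.noise ^ 2 / (6 * p.clipping ^ 2) *
        Real.log (1 / (τ * α * (1 + p.noise ^ 2 / (4 * p.clipping ^ 2))))) :
    DPFed.IsDP DPFed.ReplaceOne
        (DPFed.dpFedLS p : (Fin N → DPFed.Client d Z K) → _) ε δ ∧
      DPFed.IsDP DPFed.ReplaceOne
        (DPFed.dpFed p : (Fin N → DPFed.Client d Z K) → _) ε δ :=
  ⟨DPFed.isDP_dpFedLS p hτ0 hS hN hL hε hδ0 hδ1 hlam0 hlam1 hα hν hν1 hν2,
    DPFed.isDP_dpFedLS { p with smoothing := 0 } hτ0 hS hN hL hε hδ0 hδ1 hlam0 hlam1 hα hν hν1 hν2⟩
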